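/- Let $a:[0,1]\to\mathbb R$ satisfy $a(0)=0$ and $a>0$ on $(0,1]$, and assume that $a$ is either weakly degenerate at $0$, i.e. $a\in C[0,1]\cap C^1(0,1]$ and $K:=\sup_{x\in(0,1]}\frac{x|a'(x)|}{a(x)}\in(0,1)$, or strongly degenerate at $0$, i.e. $a\in C^1[0,1]$ and $K\in[1,2)$. Let $L^2_{1/a}(0,1)=\{u\in L^2(0,1):\int_0^1u^2/a\,dx<\infty\}$ with norm $(\int_0^1u^2/a\,dx)^{1/2}$, let $H^2_{1/a}(0,1)=L^2_{1/a}(0,1)\cap H^2_0(0,1)$ with norm $\big(\|u\|^2_{L^2_{1/a}}+\|u'\|^2_{L^2}+\|u''\|^2_{L^2}\big)^{1/2}$, and let $D(A)=\{u\in H^2_{1/a}(0,1): au''''\in L^2_{1/a}(0,1)\}$ with the graph norm of $Au:=au''''$. Let $(y^0,y^1)\in D(A)\times H^2_{1/a}(0,1)$ and let $y$ be a classical solution of $$y_{tt}+a\,y_{xxxx}=0 \text{ in } (0,\infty)\times(0,1),\quad y(t,0)=y(t,1)=y_x(t,0)=y_x(t,1)=0,\quad y(0)=y^0,\ y_t(0)=y^1,$$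 that is, $y\in C^2([0,\infty);L^2_{1/a}(0,1))\cap C^1([0,\infty);H^2_{1/a}(0,1))\cap C([0,\infty);D(A))$ and the equation holds in $L^2_{1/a}(0,1)$ for all $t\ge0$. Then $y_t$, $y_x$ and $y_{xx}$ have (unique) representatives that are continuous on $[0,\infty)\times[0,1]$, and, with these representatives, for every $T>0$, writing $Q_T=(0,T)\times(0,1)$: $y_{xx}(\cdot,1)\in L^2(0,T)$, all the integrals below converge absolutely, and $$\frac12\int_0^T y_{xx}^2(t,1)\,dt=\int_0^1\Big[\frac{x\,y_t\,y_x}{a}\Big]_{t=0}^{t=T}dx+\frac12\int_{Q_T}\frac{y_t^2}{a}\Big(1-\frac{x a'}{a}\Big)dx\,dt+\frac32\int_{Q_T}y_{xx}^2\,dx\,dt .$$ -/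

import Mathlib

open MeasureTheory Set
open scoped ContDiff

noncomputable section

namespace DegenerateBeam

/-- `a'` on `[0,1]` (one-sided at the end points). -/
def coeffDeriv (a : ℝ → ℝ) (x : ℝ) : ℝ := derivWithin a (Icc 0 1) x

/-- `K` is the supremum of `x |a'(x)| / a(x)` over `x ∈ (0,1]` (which is then finite). -/
def IsDegeneracyConstant (a : ℝ → ℝ) (K : ℝ) : Prop :=
  IsLUB ((fun x : ℝ => x * |coeffDeriv a x| / a x) '' Ioc 0 1) K

/-- `a` is weakly degenerate at `0`. -/
def WeaklyDegenerate (a : ℝ → ℝ) : Prop :=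
  ContinuousOn a (Icc 0 1) ∧ ContDiffOn ℝ 1 a (Ioc 0 1) ∧ a 0 = 0 ∧ (∀ x ∈ Ioc (0 : ℝ) 1, 0 < a x) ∧
    ∃ K, IsDegeneracyConstant a K ∧ 0 < K ∧ K < 1

/-- `a` is strongly degenerate at `0`. -/
def StronglyDegenerate (a : ℝ → ℝ) : Prop :=
  ContDiffOn ℝ 1 a (Icc 0 1) ∧ a 0 = 0 ∧ (∀ x ∈ Ioc (0 : ℝ) 1, 0 < a x) ∧
    ∃ K, IsDegeneracyConstant a K ∧ 1 ≤ K ∧ K < 2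

/-- Lebesgue measure on `(0,1)`. -/
abbrev unitVol : Measure ℝ := volume.restrict (Ioo 0 1)

/-- The measure `dx / a(x)` on `(0,1)`. -/
abbrev weightVol (a : ℝ → ℝ) : Measure ℝ :=
  unitVol.withDensity fun x => ENNReal.ofReal (1 / a x)

/-- `L²(0,1)`. -/
abbrev L2 : Type := Lp ℝ 2 unitVol

/-- The weighted space `L²_{1/a}(0,1)`, with norm `(∫₀¹ u²/a dx)^{1/2}`. -/
abbrev L2w (a : ℝ → ℝ) : Type := Lp ℝ 2 (weightVol a)

/-- `φ ∈ C_c^∞(0,1)`. -/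
def IsTestFunction (φ : ℝ → ℝ) : Prop :=
  ContDiff ℝ ∞ φ ∧ HasCompactSupport φ ∧ tsupport φ ⊆ Ioo 0 1

/-- `g` is the weak (distributional) derivative of order `k` of `f` on `(0,1)`, where `f` and `g`
are locally integrable. -/
def HasWeakDeriv (k : ℕ) (f g : ℝ → ℝ) : Prop :=
  LocallyIntegrableOn f (Ioo 0 1) ∧ LocallyIntegrableOn g (Ioo 0 1) ∧
    ∀ φ : ℝ → ℝ, IsTestFunction φ →
      ∫ x in Ioo 0 1, f x * iteratedDeriv k φ x = (-1) ^ k * ∫ x in Ioo 0 1, g x * φ x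

theorem IsTestFunction.integrableOn_mul {φ : ℝ → ℝ} (hφ : IsTestFunction φ) (k : ℕ)
    {f : ℝ → ℝ} (hf : LocallyIntegrableOn f (Ioo 0 1)) :
    IntegrableOn (fun x => f x * iteratedDeriv k φ x) (Ioo 0 1) := by
  obtain ⟨h1, h2, h3⟩ := hφ
  have hK : IntegrableOn f (tsupport φ) := hf.integrableOn_compact_subset h3 h2
  have hc : Continuous (iteratedDeriv k φ) := h1.continuous_iteratedDeriv k (by exact_mod_cast le_top)
  have hi : IntegrableOn (fun x => f x * iteratedDeriv k φ x) (tsupport φ) :=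
    hK.mul_continuousOn hc.continuousOn h2
  have hs : Function.support (fun x => f x * iteratedDeriv k φ x) ⊆ tsupport φ := by
    intro x hx
    have : iteratedDeriv k φ x ≠ 0 := right_ne_zero_of_mul hx
    by_contra hn
    apply this
    have hev : φ =ᶠ[nhds x] fun _ => 0 := notMem_tsupport_iff_eventuallyEq.mp hn
    have h0 := hev.iteratedDeriv_eq k
    rw [h0]
    simp
  exact ((integrableOn_iff_integrable_of_support_subset hs).mp hi).integrableOn

theorem HasWeakDeriv.zero (k : ℕ) : HasWeakDeriv k (fun _ => 0) (fun _ => 0) :=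
  ⟨(locallyIntegrable_const 0).locallyIntegrableOn _,
    (locallyIntegrable_const 0).locallyIntegrableOn _, by simp⟩

theorem HasWeakDeriv.add {k : ℕ} {f g f' g' : ℝ → ℝ} (h : HasWeakDeriv k f g)
    (h' : HasWeakDeriv k f' g') : HasWeakDeriv k (f + f') (g + g') := by
  refine ⟨h.1.add h'.1, h.2.1.add h'.2.1, fun φ hφ => ?_⟩
  have e1 := hφ.integrableOn_mul k h.1
  have e2 := hφ.integrableOn_mul k h'.1
  have e3 := hφ.integrableOn_mul 0 h.2.1
  have e4 := hφ.integrableOn_mul 0 h'.2.1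
  simp only [iteratedDeriv_zero] at e3 e4
  simp only [Pi.add_apply, add_mul]
  rw [integral_add e1 e2, integral_add e3 e4, h.2.2 φ hφ, h'.2.2 φ hφ, mul_add]

theorem HasWeakDeriv.smul {k : ℕ} {f g : ℝ → ℝ} (c : ℝ) (h : HasWeakDeriv k f g) :
    HasWeakDeriv k (c • f) (c • g) := by
  refine ⟨h.1.smul c, h.2.1.smul c, fun φ hφ => ?_⟩
  simp only [Pi.smul_apply, smul_eq_mul, mul_assoc]
  rw [integral_const_mul, integral_const_mul, h.2.2 φ hφ]
  ring

theorem HasWeakDeriv.congr_right {k : ℕ} {f g g' : ℝ → ℝ} (h : HasWeakDeriv k f g)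
    (hg : g' =ᵐ[unitVol] g) : HasWeakDeriv k f g' := by
  refine ⟨h.1, ?_, fun φ hφ => ?_⟩
  · rw [locallyIntegrableOn_iff isOpen_Ioo.isLocallyClosed]
    intro K hK hKc
    have h2 := (locallyIntegrableOn_iff isOpen_Ioo.isLocallyClosed).mp h.2.1 K hK hKc
    exact h2.congr (ae_mono (Measure.restrict_mono hK le_rfl) hg.symm)
  · rw [h.2.2 φ hφ]
    congr 1
    refine integral_congr_ae ?_
    filter_upwards [hg] with x hx
    rw [hx]

/-- The space `H²_{1/a}(0,1) = L²_{1/a}(0,1) ∩ H²_0(0,1)`. Its elements are recorded as triples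
`(u, u', u'')` (weak derivatives, in `L²(0,1)`), so that the topology is that of the norm
`‖u‖_{L²_{1/a}} + ‖u'‖_{L²} + ‖u''‖_{L²}`. The functions `v`, `v₁` are the continuous
representatives of `u`, `u'`, which vanish at `0` and `1`. -/
def H2w (a : ℝ → ℝ) : Submodule ℝ (L2w a × L2 × L2) where
  carrier := {p | ∃ v v₁ : ℝ → ℝ, ContinuousOn v (Icc 0 1) ∧ ContinuousOn v₁ (Icc 0 1) ∧
    v =ᵐ[weightVol a] p.1 ∧ v₁ =ᵐ[unitVol] p.2.1 ∧
    HasWeakDeriv 1 v v₁ ∧ HasWeakDeriv 2 v p.2.2 ∧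
    v 0 = 0 ∧ v 1 = 0 ∧ v₁ 0 = 0 ∧ v₁ 1 = 0}
  add_mem' := by
    rintro p q ⟨v, v₁, c, c₁, e, e₁, d, d₂, z1, z2, z3, z4⟩
      ⟨w, w₁, c', c₁', e', e₁', d', d₂', z1', z2', z3', z4'⟩
    refine ⟨v + w, v₁ + w₁, c.add c', c₁.add c₁', (e.add e').trans (Lp.coeFn_add _ _).symm,
      (e₁.add e₁').trans (Lp.coeFn_add _ _).symm, d.add d',
      (d₂.add d₂').congr_right (Lp.coeFn_add _ _), ?_, ?_, ?_, ?_⟩ <;> simp [*]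
  zero_mem' := by
    refine ⟨0, 0, continuousOn_const, continuousOn_const, (Lp.coeFn_zero _ _ _).symm,
      (Lp.coeFn_zero _ _ _).symm, HasWeakDeriv.zero 1,
      (HasWeakDeriv.zero 2).congr_right (Lp.coeFn_zero _ _ _), rfl, rfl, rfl, rfl⟩
  smul_mem' := by
    rintro r p ⟨v, v₁, c, c₁, e, e₁, d, d₂, z1, z2, z3, z4⟩
    refine ⟨r • v, r • v₁, c.const_smul r, c₁.const_smul r,
      (e.const_smul r).trans (Lp.coeFn_smul _ _).symm,
      (e₁.const_smul r).trans (Lp.coeFn_smul _ _).symm, d.smul r,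
      (d₂.smul r).congr_right (Lp.coeFn_smul _ _), ?_, ?_, ?_, ?_⟩ <;> simp [*]

/-- The element `u` of `H²_{1/a}(0,1)`, seen in `L²_{1/a}(0,1)`. -/
def toL2w {a : ℝ → ℝ} (u : H2w a) : L2w a := u.1.1

/-- The weak derivative `u'` of `u ∈ H²_{1/a}(0,1)`. -/
def weakD1 {a : ℝ → ℝ} (u : H2w a) : L2 := u.1.2.1

/-- The weak derivative `u''` of `u ∈ H²_{1/a}(0,1)`. -/
def weakD2 {a : ℝ → ℝ} (u : H2w a) : L2 := u.1.2.2

/-- The domain `D(A) = {u ∈ H²_{1/a}(0,1) : a u'''' ∈ L²_{1/a}(0,1)}` of `A u = a u''''`, with the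
graph norm. Its elements are recorded as pairs `(u, A u)`; here `q` is the weak derivative `u''''`. -/
def DomA (a : ℝ → ℝ) : Submodule ℝ (H2w a × L2w a) where
  carrier := {p | ∃ v q : ℝ → ℝ, v =ᵐ[weightVol a] toL2w p.1 ∧ HasWeakDeriv 4 v q ∧
    (fun x => a x * q x) =ᵐ[weightVol a] p.2}
  add_mem' := by
    rintro p p' ⟨v, q, e, d, h⟩ ⟨v', q', e', d', h'⟩
    refine ⟨v + v', q + q', (e.add e').trans (Lp.coeFn_add _ _).symm, d.add d', ?_⟩
    refine Filter.EventuallyEq.trans ?_ ((h.add h').trans (Lp.coeFn_add _ _).symm)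
    exact Filter.Eventually.of_forall fun x => by simp [mul_add]
  zero_mem' := by
    refine ⟨0, 0, (Lp.coeFn_zero _ _ _).symm, HasWeakDeriv.zero 4, ?_⟩
    refine Filter.EventuallyEq.trans ?_ (Lp.coeFn_zero _ _ _).symm
    exact Filter.Eventually.of_forall fun x => by simp
  smul_mem' := by
    rintro r p ⟨v, q, e, d, h⟩
    refine ⟨r • v, r • q, (e.const_smul r).trans (Lp.coeFn_smul _ _).symm, d.smul r, ?_⟩
    refine Filter.EventuallyEq.trans ?_ ((h.const_smul r).trans (Lp.coeFn_smul _ _).symm)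
    exact Filter.Eventually.of_forall fun x => by simp [mul_left_comm]

/-- The element `u` of `D(A)`, seen in `H²_{1/a}(0,1)`. -/
def toH2w {a : ℝ → ℝ} (u : DomA a) : H2w a := u.1.1

/-- `A u = a u''''` for `u ∈ D(A)`. -/
def opA {a : ℝ → ℝ} (u : DomA a) : L2w a := u.1.2

/-- The time derivative `y_t(t) ∈ H²_{1/a}(0,1)`, for `t ∈ [0,∞)`. -/
def timeDeriv {a : ℝ → ℝ} (y : ℝ → DomA a) (t : ℝ) : H2w a :=
  derivWithin (fun s => toH2w (y s)) (Ici 0) t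

/-- `y` is a classical solution of `y_tt + a y_xxxx = 0` in `(0,∞) × (0,1)` with
`y = y_x = 0` at `x = 0, 1` and initial data `(y⁰, y¹) ∈ D(A) × H²_{1/a}(0,1)`:
`y ∈ C²([0,∞); L²_{1/a}) ∩ C¹([0,∞); H²_{1/a}) ∩ C([0,∞); D(A))`, and the equation holds in
`L²_{1/a}` for all `t ≥ 0`. Only the values `y t` with `t ≥ 0` matter; the boundary conditions are
part of the definition of `H²_{1/a}`. -/
structure IsClassicalSolution (a : ℝ → ℝ) (y₀ : DomA a) (y₁ : H2w a) (y : ℝ → DomA a) : Prop where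
  contDiffOn_L2w : ContDiffOn ℝ 2 (fun t => toL2w (toH2w (y t))) (Ici 0)
  contDiffOn_H2w : ContDiffOn ℝ 1 (fun t => toH2w (y t)) (Ici 0)
  continuousOn_DomA : ContinuousOn y (Ici 0)
  equation : ∀ t ∈ Ici (0 : ℝ),
    iteratedDerivWithin 2 (fun s => toL2w (toH2w (y s))) (Ici 0) t + opA (y t) = 0
  initial : y 0 = y₀
  initial_deriv : timeDeriv y 0 = y₁

/-- `g` is a continuous function on `[0,∞) × [0,1]` such that `g(t,·)` represents the class of
`f t` (a function on `(0,1)` up to null sets) for every `t ≥ 0`. There is at most one such `g`, up to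
its values outside `[0,∞) × [0,1]`. -/
def IsContinuousRep (g : ℝ → ℝ → ℝ) (f : ℝ → ℝ → ℝ) : Prop :=
  ContinuousOn (fun p : ℝ × ℝ => g p.1 p.2) (Ici 0 ×ˢ Icc 0 1) ∧
    ∀ t ∈ Ici (0 : ℝ), g t =ᵐ[unitVol] f t

end DegenerateBeam

end

/-!
The identity comes from multiplying the equation by `x y_x / a` and integrating over `Q_T`. Both kinds
of degeneracy enter only through `a(x) ≥ a(1) x²` (`exists_coeffBounds`) and through the boundedness of
`x a' / a`. The first bound makes `p ↦ x p / a` a bounded operator `N : L²_{1/a} → L²`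
(`CoeffBounds.mulDiv`), so that `F(t) = ∫₀¹ x y_t y_x / a dx = ⟪N y_t(t), y_x(t)⟫` is a continuous
bilinear expression in curves which are `C¹` with values in `L²_{1/a}` and `L²`. By the equation,
`F' = ⟪N y_t, y_tx⟫ - ⟪N (A y), y_x⟫`, and the time integral of `F'` is `F(T) - F(0)`. No regularity of
`y` jointly in `(t, x)` is needed, because both brackets are evaluated at fixed `t`:

* `⟪N v, v'⟫ = -1/2 ∫₀¹ (v²/a)(1 - x a'/a)` for `v ∈ H²_{1/a}` (`CoeffBounds.inner_toL2w_slope`), an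
  integration by parts whose boundary term `x v²/a` vanishes at `0` since `v = O(x)`;
* `⟪N (A u), u'⟫ = ∫₀¹ x u' u'''' = 3/2 ∫₀¹ u''² - 1/2 u''(1)²` for `u ∈ D(A)`
  (`CoeffBounds.inner_opA_slope`).

For the second one, `q = u''''` need not be integrable near `0`, but `x q = N (A u)` lies in `L²`. By
Fubini's theorem (`integral_primitive_mul`) this suffices for `Z(s) = ∫ₛ¹ q` to be integrable and for
`∫₀¹ x u' q = ∫₀¹ (x u')' Z`. Moreover `u''` is affine plus `∫ₓ¹ Z` (`CoeffBounds.exists_curvature`),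
by the du Bois-Reymond lemma, and its affine part is controlled by the boundary conditions. Hence
`u''` is continuous on `[0,1]`, with a uniform bound by the graph norm of `A`, and what remains is the
fundamental theorem of calculus. Uniform bounds of this type also make the representatives of `y_t`,
`y_x` and `y_xx` jointly continuous (`continuousOn_rep`).
-/

noncomputable section

namespace DegenerateBeam

/-! ### Test functions and the du Bois-Reymond lemma -/

theorem IsTestFunction.deriv {φ : ℝ → ℝ} (hφ : IsTestFunction φ) : IsTestFunction (deriv φ) :=
  ⟨(contDiff_infty_iff_deriv.mp hφ.1).2, hφ.2.1.deriv, tsupport_deriv_subset.trans hφ.2.2⟩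

theorem IsTestFunction.smul {φ : ℝ → ℝ} (c : ℝ) (hφ : IsTestFunction φ) :
    IsTestFunction (c • φ) :=
  ⟨contDiff_const.smul hφ.1, hφ.2.1.smul_left (f := fun _ => c),
    (tsupport_smul_subset_right (fun _ => c) φ).trans hφ.2.2⟩

theorem IsTestFunction.sub {φ ψ : ℝ → ℝ} (hφ : IsTestFunction φ) (hψ : IsTestFunction ψ) :
    IsTestFunction (φ - ψ) :=
  ⟨hφ.1.sub hψ.1, hφ.2.1.sub hψ.2.1,
    (tsupport_sub φ ψ).trans (union_subset hφ.2.2 hψ.2.2)⟩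

theorem IsTestFunction.eq_zero {φ : ℝ → ℝ} (hφ : IsTestFunction φ) {x : ℝ}
    (hx : x ∉ Ioo (0 : ℝ) 1) : φ x = 0 :=
  image_eq_zero_of_notMem_tsupport fun h => hx (hφ.2.2 h)

theorem IsTestFunction.hasDerivAt {φ : ℝ → ℝ} (hφ : IsTestFunction φ) (x : ℝ) :
    HasDerivAt φ (_root_.deriv φ x) x :=
  ((hφ.1.differentiable (by simp)) x).hasDerivAt

theorem IsTestFunction.continuous {φ : ℝ → ℝ} (hφ : IsTestFunction φ) : Continuous φ :=
  hφ.1.continuous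

theorem integral_unit (f : ℝ → ℝ) : ∫ x in Ioo (0 : ℝ) 1, f x = ∫ x in (0 : ℝ)..1, f x := by
  rw [intervalIntegral.integral_of_le zero_le_one, integral_Ioc_eq_integral_Ioo]

theorem IsTestFunction.integral_deriv {φ : ℝ → ℝ} (hφ : IsTestFunction φ) (x : ℝ) :
    ∫ s in (0 : ℝ)..x, _root_.deriv φ s = φ x := by
  rw [intervalIntegral.integral_eq_sub_of_hasDerivAt (fun s _ => hφ.hasDerivAt s)
    (hφ.deriv.continuous.intervalIntegrable _ _), hφ.eq_zero (x := 0) (by simp), sub_zero]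

theorem exists_isTestFunction_integral_eq_one :
    ∃ ρ : ℝ → ℝ, IsTestFunction ρ ∧ ∫ x in Ioo (0 : ℝ) 1, ρ x = 1 := by
  let b : ContDiffBump (1 / 2 : ℝ) := ⟨1 / 8, 1 / 4, by norm_num, by norm_num⟩
  have hs : tsupport (b.normed volume) ⊆ Ioo (0 : ℝ) 1 := by
    rw [b.tsupport_normed_eq, Real.closedBall_eq_Icc]
    intro x hx
    have h1 : b.rOut = 1 / 4 := rfl
    rw [h1] at hx
    constructor <;> linarith [hx.1, hx.2]
  refine ⟨b.normed volume, ⟨b.contDiff_normed, b.hasCompactSupport_normed, hs⟩, ?_⟩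
  rw [setIntegral_eq_integral_of_forall_compl_eq_zero, b.integral_normed]
  exact fun x hx => image_eq_zero_of_notMem_tsupport fun h => hx (hs h)

/-- A test function of vanishing mean has a test function as primitive. -/
theorem IsTestFunction.exists_primitive {ψ : ℝ → ℝ} (hψ : IsTestFunction ψ)
    (h0 : ∫ x in Ioo (0 : ℝ) 1, ψ x = 0) : ∃ φ, IsTestFunction φ ∧ _root_.deriv φ = ψ := by
  obtain ⟨a, b, ha, hb, hab⟩ : ∃ a b : ℝ, 0 < a ∧ b < 1 ∧ tsupport ψ ⊆ Icc a b := by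
    rcases (tsupport ψ).eq_empty_or_nonempty with h | h
    · exact ⟨1, 0, one_pos, one_pos, by simp [h]⟩
    · obtain ⟨a, ha⟩ := hψ.2.1.exists_isLeast h
      obtain ⟨b, hb⟩ := hψ.2.1.exists_isGreatest h
      exact ⟨a, b, (hψ.2.2 ha.1).1, (hψ.2.2 hb.1).2, fun x hx => ⟨ha.2 hx, hb.2 hx⟩⟩
  have hz : ∀ x, x ∉ Icc a b → ψ x = 0 := fun x hx =>
    image_eq_zero_of_notMem_tsupport fun h => hx (hab h)
  have hd : ∀ x, HasDerivAt (fun x => ∫ t in (0 : ℝ)..x, ψ t) (ψ x) x := fun x =>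
    intervalIntegral.integral_hasDerivAt_right (hψ.continuous.intervalIntegrable _ _)
      (hψ.continuous.stronglyMeasurableAtFilter _ _) hψ.continuous.continuousAt
  have hderiv : _root_.deriv (fun x => ∫ t in (0 : ℝ)..x, ψ t) = ψ := funext fun x => (hd x).deriv
  have hsupp : Function.support (fun x => ∫ t in (0 : ℝ)..x, ψ t) ⊆ Icc a b := by
    intro x hx
    by_contra hn
    apply hx
    rcases lt_or_ge x a with h | h
    · refine intervalIntegral.integral_zero_ae (Filter.Eventually.of_forall fun t ht => hz t ?_)
      have h2 : t ≤ max 0 x := ht.2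
      exact fun hc => absurd (hc.1.trans h2) (not_le.mpr (max_lt ha h))
    · have hxb : b < x := by
        by_contra hc
        exact hn ⟨h, not_lt.mp hc⟩
      have e := intervalIntegral.integral_add_adjacent_intervals
        (hψ.continuous.intervalIntegrable (μ := volume) 0 x)
        (hψ.continuous.intervalIntegrable (μ := volume) x 1)
      have e2 : ∫ t in x..1, ψ t = 0 := by
        refine intervalIntegral.integral_zero_ae (Filter.Eventually.of_forall fun t ht => hz t ?_)
        have h2 : min x 1 < t := ht.1
        exact fun hc => absurd (h2.trans_le hc.2) (not_lt.mpr (le_min hxb.le hb.le))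
      rw [← integral_unit, h0, e2, add_zero] at e
      exact e
  have hts := closure_minimal hsupp isClosed_Icc
  refine ⟨fun x => ∫ t in (0 : ℝ)..x, ψ t, ⟨?_, ?_, ?_⟩, hderiv⟩
  · rw [contDiff_infty_iff_deriv, hderiv]
    exact ⟨fun x => (hd x).differentiableAt, hψ.1⟩
  · exact HasCompactSupport.of_support_subset_isCompact isCompact_Icc hsupp
  · exact hts.trans fun x hx => ⟨ha.trans_le hx.1, hx.2.trans_lt hb⟩

theorem IsTestFunction.integrableOn {φ : ℝ → ℝ} (hφ : IsTestFunction φ) :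
    IntegrableOn φ (Ioo 0 1) :=
  (hφ.continuous.integrable_of_hasCompactSupport hφ.2.1).integrableOn

/-- The du Bois-Reymond lemma. -/
theorem ae_eq_const_of_integral_mul_deriv_eq_zero {f : ℝ → ℝ}
    (hf : LocallyIntegrableOn f (Ioo 0 1))
    (h : ∀ φ, IsTestFunction φ → ∫ x in Ioo (0 : ℝ) 1, f x * deriv φ x = 0) :
    ∃ c : ℝ, f =ᵐ[unitVol] fun _ => c := by
  obtain ⟨ρ, hρ, hρ1⟩ := exists_isTestFunction_integral_eq_one
  set c := ∫ x in Ioo (0 : ℝ) 1, f x * ρ x with hc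
  refine ⟨c, ?_⟩
  have hint : ∀ ψ, IsTestFunction ψ → IntegrableOn (fun x => f x * ψ x) (Ioo 0 1) := fun ψ hψ => by
    simpa using hψ.integrableOn_mul 0 hf
  have key : ∀ᵐ x, x ∈ Ioo (0 : ℝ) 1 → f x - c = 0 := by
    refine isOpen_Ioo.ae_eq_zero_of_integral_contDiff_smul_eq_zero
      (f := fun x => f x - c) (hf.sub ((locallyIntegrable_const c).locallyIntegrableOn _)) ?_
    intro ψ h1 h2 h3
    have hψ : IsTestFunction ψ := ⟨h1, h2, h3⟩
    rw [← setIntegral_eq_integral_of_forall_compl_eq_zero (s := Ioo 0 1)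
      (fun x hx => by rw [hψ.eq_zero hx, zero_smul])]
    set m := ∫ x in Ioo (0 : ℝ) 1, ψ x with hm
    -- `ψ - (∫ ψ) ρ` has vanishing mean, hence is the derivative of a test function
    have hχ := hψ.sub (hρ.smul m)
    obtain ⟨φ, hφ, hφd⟩ := hχ.exists_primitive (by
      simp only [Pi.sub_apply, Pi.smul_apply, smul_eq_mul]
      rw [integral_sub hψ.integrableOn (hρ.integrableOn.const_mul m), integral_const_mul, hρ1, ← hm]
      ring)
    have h0 := h φ hφ
    rw [hφd] at h0
    simp only [Pi.sub_apply, Pi.smul_apply, smul_eq_mul] at h0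
    have e1 : ∀ x, f x * (ψ x - m * ρ x) = f x * ψ x - m * (f x * ρ x) := fun x => by ring
    simp only [e1] at h0
    rw [integral_sub (hint ψ hψ) ((hint ρ hρ).const_mul m), integral_const_mul, ← hc] at h0
    have e2 : ∀ x, ψ x • (f x - c) = f x * ψ x - c * ψ x := fun x => by
      rw [smul_eq_mul]; ring
    simp only [e2]
    rw [integral_sub (hint ψ hψ) (hψ.integrableOn.const_mul c), integral_const_mul, ← hm]
    linarith
  rw [Filter.EventuallyEq, ae_restrict_iff' measurableSet_Ioo]
  filter_upwards [key] with x hx hx'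
  linarith [hx hx']

/-! ### Exchanging the order of integration -/

/-- Fubini's theorem in the form `∫₀¹ (∫₀ˣ b) q dx = ∫₀¹ b(s) (∫ₛ¹ q) ds`. Only `x q(x)`, not `q`,
needs to be integrable up to `0`. -/
theorem integral_primitive_mul {b q : ℝ → ℝ} (hq : IntegrableOn (fun x => x * q x) (Ioo 0 1))
    (hb : ContinuousOn b (Icc 0 1)) :
    IntegrableOn (fun s => b s * ∫ x in s..1, q x) (Ioo 0 1) ∧
    ∫ x in Ioo (0 : ℝ) 1, (∫ s in (0 : ℝ)..x, b s) * q x =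
      ∫ s in Ioo (0 : ℝ) 1, b s * ∫ x in s..1, q x := by
  obtain ⟨C, hC⟩ := isCompact_Icc.exists_bound_of_continuousOn hb
  have hqm : AEStronglyMeasurable q unitVol := by
    have h1 : AEStronglyMeasurable (fun x : ℝ => x⁻¹ * (x * q x)) unitVol :=
      measurable_inv.aestronglyMeasurable.mul hq.aestronglyMeasurable
    refine h1.congr ?_
    filter_upwards [ae_restrict_mem measurableSet_Ioo] with x hx
    field_simp [hx.1.ne']
  have hbm : AEStronglyMeasurable b unitVol :=
    (hb.mono Ioo_subset_Icc_self).aestronglyMeasurable measurableSet_Ioo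
  let k : ℝ × ℝ → ℝ := {p : ℝ × ℝ | p.1 < p.2}.indicator fun p => b p.1 * q p.2
  have hkm : AEStronglyMeasurable k (unitVol.prod unitVol) :=
    (hbm.comp_fst.mul hqm.comp_snd).indicator (measurableSet_lt measurable_fst measurable_snd)
  -- the two families of slices of the kernel
  have hx1 : ∀ x, (fun s => k (s, x)) = (Iio x).indicator fun s => b s * q x := fun x => by
    ext s
    simp [k, indicator]
  have hs1 : ∀ s, (fun x => k (s, x)) = (Ioi s).indicator fun x => b s * q x := fun s => by
    ext s
    simp [k, indicator]
  have hIx : ∀ x ∈ Ioo (0 : ℝ) 1, Ioo (0 : ℝ) 1 ∩ Iio x = Ioo 0 x := fun x hx => by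
    ext s
    simp only [mem_inter_iff, mem_Ioo, mem_Iio]
    exact ⟨fun h => ⟨h.1.1, h.2⟩, fun h => ⟨⟨h.1, h.2.trans hx.2⟩, h.2⟩⟩
  have hIs : ∀ s ∈ Ioo (0 : ℝ) 1, Ioo (0 : ℝ) 1 ∩ Ioi s = Ioo s 1 := fun s hs => by
    ext x
    simp only [mem_inter_iff, mem_Ioo, mem_Ioi]
    exact ⟨fun h => ⟨h.2, h.1.2⟩, fun h => ⟨⟨hs.1.trans h.1, h.2⟩, h.1⟩⟩
  have hk : Integrable k (unitVol.prod unitVol) := by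
    rw [integrable_prod_iff' hkm]
    constructor
    · filter_upwards with x
      rw [hx1 x]
      exact (((hb.integrableOn_Icc).mono_set Ioo_subset_Icc_self).mul_const _).indicator
        measurableSet_Iio
    · refine (hq.norm.const_mul C).mono' hkm.norm.prod_swap.integral_prod_right' ?_
      filter_upwards [ae_restrict_mem measurableSet_Ioo] with x hx
      have e1 : ∀ s, ‖k (s, x)‖ = (Iio x).indicator (fun s => ‖b s * q x‖) s := fun s => by
        rw [congrFun (hx1 x) s, norm_indicator_eq_indicator_norm]
      simp only [e1]
      rw [Real.norm_of_nonneg (integral_nonneg fun s => indicator_nonneg (fun _ _ => norm_nonneg _) _),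
        setIntegral_indicator measurableSet_Iio, hIx x hx]
      have : ∀ s ∈ Ioo 0 x, ‖b s * q x‖ ≤ C * ‖q x‖ := fun s hs => by
        rw [norm_mul]
        exact mul_le_mul_of_nonneg_right (hC s ⟨hs.1.le, (hs.2.trans hx.2).le⟩) (norm_nonneg _)
      have h2 := norm_setIntegral_le_of_norm_le_const (μ := volume) (s := Ioo 0 x)
        (f := fun s => ‖b s * q x‖) (C := C * ‖q x‖) (by simp)
        (fun s hs => by rw [norm_norm]; exact this s hs)
      refine (le_abs_self _).trans (h2.trans (le_of_eq ?_))
      rw [norm_mul, Real.norm_of_nonneg hx.1.le]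
      simp [Measure.real, hx.1.le]
      ring
  have hinner1 : ∀ x ∈ Ioo (0 : ℝ) 1, ∫ s, k (s, x) ∂unitVol = (∫ s in (0 : ℝ)..x, b s) * q x := by
    intro x hx
    rw [hx1 x, setIntegral_indicator measurableSet_Iio, hIx x hx, integral_mul_const,
      intervalIntegral.integral_of_le hx.1.le, integral_Ioc_eq_integral_Ioo]
  have hinner2 : ∀ s ∈ Ioo (0 : ℝ) 1, ∫ x, k (s, x) ∂unitVol = b s * ∫ x in s..1, q x := by
    intro s hs
    rw [hs1 s, setIntegral_indicator measurableSet_Ioi, hIs s hs, integral_const_mul,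
      intervalIntegral.integral_of_le hs.2.le, integral_Ioc_eq_integral_Ioo]
  constructor
  · refine hk.integral_prod_left.congr ?_
    filter_upwards [ae_restrict_mem measurableSet_Ioo] with s hs using hinner2 s hs
  · rw [← setIntegral_congr_fun measurableSet_Ioo hinner1,
      ← setIntegral_congr_fun measurableSet_Ioo hinner2]
    exact (integral_integral_swap (f := fun s x => k (s, x)) hk).symm

/-- Hardy's inequality in `L¹`: `∫₀¹ |∫ₛ¹ q| ds ≤ ∫₀¹ x |q(x)| dx`. -/
theorem integral_norm_tail_le {q : ℝ → ℝ} (hq : IntegrableOn (fun x => x * q x) (Ioo 0 1)) :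
    IntegrableOn (fun s => ∫ x in s..1, q x) (Ioo 0 1) ∧
      ∫ s in Ioo (0 : ℝ) 1, ‖∫ x in s..1, q x‖ ≤ ∫ x in Ioo (0 : ℝ) 1, ‖x * q x‖ := by
  have h1 := (integral_primitive_mul (b := fun _ => 1) hq continuousOn_const).1
  simp only [one_mul] at h1
  have hq' : IntegrableOn (fun x => x * ‖q x‖) (Ioo 0 1) := by
    refine hq.norm.congr ?_
    filter_upwards [ae_restrict_mem measurableSet_Ioo] with x hx
    rw [norm_mul, Real.norm_of_nonneg hx.1.le]
  have h2 := integral_primitive_mul (b := fun _ => 1) hq' continuousOn_const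
  simp only [one_mul] at h2
  refine ⟨h1, ?_⟩
  calc ∫ s in Ioo (0 : ℝ) 1, ‖∫ x in s..1, q x‖
      ≤ ∫ s in Ioo (0 : ℝ) 1, ∫ x in s..1, ‖q x‖ :=
        setIntegral_mono_on h1.norm h2.1 measurableSet_Ioo fun s hs =>
          intervalIntegral.norm_integral_le_integral_norm hs.2.le
    _ = ∫ x in Ioo (0 : ℝ) 1, ‖x * q x‖ := by
        rw [← h2.2]
        refine setIntegral_congr_fun measurableSet_Ioo fun x hx => ?_
        simp [abs_of_pos hx.1]

theorem intervalIntegrable_of_mul_id {q : ℝ → ℝ} (hq : IntegrableOn (fun x => x * q x) (Ioo 0 1))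
    {s : ℝ} (hs : s ∈ Ioo (0 : ℝ) 1) : IntervalIntegrable q volume s 1 := by
  rw [intervalIntegrable_iff_integrableOn_Ioo_of_le hs.2.le]
  have h1 : IntegrableOn (fun x => x * q x) (Ioo s 1) := hq.mono_set (Ioo_subset_Ioo_left hs.1.le)
  have h2 : AEStronglyMeasurable (fun x : ℝ => x⁻¹ * (x * q x)) (volume.restrict (Ioo s 1)) :=
    measurable_inv.aestronglyMeasurable.mul h1.aestronglyMeasurable
  have h3 : ∀ᵐ x ∂(volume.restrict (Ioo s 1)), x⁻¹ * (x * q x) = q x := by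
    filter_upwards [ae_restrict_mem measurableSet_Ioo] with x hx
    field_simp [(hs.1.trans hx.1).ne']
  refine (h1.norm.const_mul s⁻¹).mono' (h2.congr h3) ?_
  filter_upwards [ae_restrict_mem measurableSet_Ioo] with x hx
  have hx0 : 0 < x := hs.1.trans hx.1
  rw [norm_mul, Real.norm_of_nonneg hx0.le, ← mul_assoc]
  refine le_mul_of_one_le_left (norm_nonneg _) ?_
  rw [inv_mul_eq_div, one_le_div hs.1]
  exact hx.1.le

theorem continuousOn_tail {q : ℝ → ℝ} (hq : IntegrableOn (fun x => x * q x) (Ioo 0 1)) :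
    ContinuousOn (fun s => ∫ x in s..1, q x) (Ioo 0 1) := by
  intro s hs
  have hs2 : s / 2 ∈ Ioo (0 : ℝ) 1 := ⟨by linarith [hs.1], by linarith [hs.1, hs.2]⟩
  have hi := intervalIntegrable_of_mul_id hq hs2
  have hc : ContinuousOn (fun s => ∫ x in s..1, q x) (uIcc (s / 2) 1) := by
    have h := intervalIntegral.continuousOn_primitive_interval_left
      (μ := volume) (f := q) (a := s / 2) (b := 1)
      ((intervalIntegrable_iff_integrableOn_Icc_of_le hs2.2.le).mp hi |>.mono_set
        (by rw [uIcc_of_le hs2.2.le]))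
    exact h
  rw [uIcc_of_le hs2.2.le] at hc
  exact (hc.continuousAt (Icc_mem_nhds (by linarith [hs.1]) hs.2)).continuousWithinAt

/-- The distributional form of `(∫ₛ¹ q)' = -q`. -/
theorem IsTestFunction.integral_deriv_mul_tail {φ q : ℝ → ℝ} (hφ : IsTestFunction φ)
    (hq : IntegrableOn (fun x => x * q x) (Ioo 0 1)) :
    ∫ s in Ioo (0 : ℝ) 1, _root_.deriv φ s * ∫ x in s..1, q x =
      ∫ x in Ioo (0 : ℝ) 1, φ x * q x := by
  rw [← (integral_primitive_mul hq hφ.deriv.continuous.continuousOn).2]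
  simp only [hφ.integral_deriv]

theorem integrableOn_id_mul {q : ℝ → ℝ} (hq : IntegrableOn q (Ioo 0 1)) :
    IntegrableOn (fun x => x * q x) (Ioo 0 1) := by
  refine hq.norm.mono' (measurable_id.aestronglyMeasurable.mul hq.aestronglyMeasurable) ?_
  filter_upwards [ae_restrict_mem measurableSet_Ioo] with x hx
  rw [norm_mul, Real.norm_of_nonneg hx.1.le]
  exact mul_le_of_le_one_left (norm_nonneg _) hx.2.le

/-- A function whose distributional derivative is integrable is the sum of a constant and the
primitive of that derivative. -/
theorem ae_eq_const_sub_tail {f q : ℝ → ℝ} (hf : LocallyIntegrableOn f (Ioo 0 1))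
    (hq : IntegrableOn (fun x => x * q x) (Ioo 0 1))
    (h : ∀ φ, IsTestFunction φ →
      ∫ x in Ioo (0 : ℝ) 1, f x * deriv φ x = -∫ x in Ioo (0 : ℝ) 1, q x * φ x) :
    ∃ c : ℝ, f =ᵐ[unitVol] fun s => c - ∫ x in s..1, q x := by
  have hZ := (integral_norm_tail_le hq).1
  have hZl := hZ.locallyIntegrableOn
  obtain ⟨c, hc⟩ := ae_eq_const_of_integral_mul_deriv_eq_zero (hf.add hZl) (fun φ hφ => by
    have i1 := hφ.integrableOn_mul 1 hf
    have i2 := hφ.integrableOn_mul 1 hZl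
    rw [iteratedDeriv_one] at i1 i2
    simp only [Pi.add_apply, add_mul]
    rw [integral_add i1 i2, h φ hφ]
    have e := hφ.integral_deriv_mul_tail hq
    simp only [mul_comm] at e ⊢
    rw [e]
    ring)
  refine ⟨c, ?_⟩
  filter_upwards [hc] with x hx
  simp only [Pi.add_apply] at hx
  linarith

/-! ### The coefficient -/

/-- What the argument uses of the coefficient: both kinds of degeneracy force `c x² ≤ a(x)`, and
bound `x a'(x) / a(x)`. -/
structure CoeffBounds (a : ℝ → ℝ) (c K : ℝ) : Prop where
  c_pos : 0 < c
  lower : ∀ x ∈ Ioc (0 : ℝ) 1, c * x ^ 2 ≤ a x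
  continuousOn : ContinuousOn a (Ioc 0 1)
  hasDerivAt : ∀ x ∈ Ioo (0 : ℝ) 1, HasDerivAt a (coeffDeriv a x) x
  continuousOn_deriv : ContinuousOn (coeffDeriv a) (Ioo 0 1)
  abs_deriv_le : ∀ x ∈ Ioo (0 : ℝ) 1, |x * coeffDeriv a x / a x| ≤ K

theorem CoeffBounds.pos {a : ℝ → ℝ} {c K : ℝ} (h : CoeffBounds a c K) {x : ℝ}
    (hx : x ∈ Ioc (0 : ℝ) 1) : 0 < a x :=
  (mul_pos h.c_pos (pow_pos hx.1 2)).trans_le (h.lower x hx)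

theorem CoeffBounds.continuousOn_Ioo {a : ℝ → ℝ} {c K : ℝ} (h : CoeffBounds a c K) :
    ContinuousOn a (Ioo 0 1) := h.continuousOn.mono Ioo_subset_Ioc_self

/-- Since `x a' ≤ K a ≤ 2 a`, the function `a(x) / x²` is nonincreasing, so that
`a(x) ≥ a(1) x²`. -/
theorem exists_coeffBounds {a : ℝ → ℝ} (ha : WeaklyDegenerate a ∨ StronglyDegenerate a) :
    ∃ c K, CoeffBounds a c K := by
  obtain ⟨hC, hpos, K, hK, hK2⟩ : ContDiffOn ℝ 1 a (Ioc 0 1) ∧ (∀ x ∈ Ioc (0 : ℝ) 1, 0 < a x) ∧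
      ∃ K, IsDegeneracyConstant a K ∧ K < 2 := by
    rcases ha with ⟨_, h1, _, h2, K, hK, _, h3⟩ | ⟨h1, _, h2, K, hK, _, h3⟩
    · exact ⟨h1, h2, K, hK, by linarith⟩
    · exact ⟨h1.mono Ioc_subset_Icc_self, h2, K, hK, h3⟩
  have hd : ∀ x ∈ Ioo (0 : ℝ) 1, HasDerivAt a (coeffDeriv a x) x := fun x hx => by
    have h1 := ((hC.differentiableOn one_ne_zero) x (Ioo_subset_Ioc_self hx)).differentiableAt
      (Ioc_mem_nhds hx.1 hx.2)
    rw [coeffDeriv, derivWithin_of_mem_nhds (Icc_mem_nhds hx.1 hx.2)]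
    exact h1.hasDerivAt
  have hle : ∀ x ∈ Ioo (0 : ℝ) 1, x * |coeffDeriv a x| / a x ≤ K := fun x hx =>
    hK.1 ⟨x, Ioo_subset_Ioc_self hx, rfl⟩
  refine ⟨a 1, K, hpos 1 (by simp), ?_, hC.continuousOn, hd, ?_, ?_⟩
  · have hx0 : ∀ x ∈ Ioc (0 : ℝ) 1, x ^ 2 ≠ 0 := fun x hx => (pow_pos hx.1 2).ne'
    have hdg : ∀ x ∈ Ioo (0 : ℝ) 1, HasDerivAt (fun x => a x / x ^ 2)
        ((coeffDeriv a x * x ^ 2 - a x * (2 * x)) / (x ^ 2) ^ 2) x := fun x hx => by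
      have h2 : HasDerivAt (fun x : ℝ => x ^ 2) (2 * x) x := by simpa using hasDerivAt_pow 2 x
      exact (hd x hx).div h2 (hx0 x (Ioo_subset_Ioc_self hx))
    have hanti : AntitoneOn (fun x => a x / x ^ 2) (Ioc 0 1) := by
      refine antitoneOn_of_deriv_nonpos (convex_Ioc 0 1)
        (hC.continuousOn.div (continuousOn_id.pow 2) hx0) ?_ ?_
      · rw [interior_Ioc]
        exact fun x hx => (hdg x hx).differentiableAt.differentiableWithinAt
      · rw [interior_Ioc]
        intro x hx
        rw [(hdg x hx).deriv]
        refine div_nonpos_of_nonpos_of_nonneg ?_ (by positivity)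
        have hax := hpos x (Ioo_subset_Ioc_self hx)
        have h1 := hle x hx
        rw [div_le_iff₀ hax] at h1
        have h2 : x * coeffDeriv a x ≤ x * |coeffDeriv a x| :=
          mul_le_mul_of_nonneg_left (le_abs_self _) hx.1.le
        have h3 : x * coeffDeriv a x ≤ 2 * a x := by nlinarith
        nlinarith [hx.1]
    intro x hx
    have h1 := hanti hx (right_mem_Ioc.mpr one_pos) hx.2
    simp only [one_pow, div_one] at h1
    rwa [le_div_iff₀ (pow_pos hx.1 2)] at h1
  · refine ((hC.mono Ioo_subset_Ioc_self).continuousOn_deriv_of_isOpen isOpen_Ioo le_rfl).congr ?_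
    exact fun x hx => (hd x hx).deriv.symm
  · intro x hx
    rw [abs_div, abs_mul, abs_of_pos hx.1, abs_of_pos (hpos x (Ioo_subset_Ioc_self hx))]
    exact hle x hx

variable {a : ℝ → ℝ} {c K : ℝ}

theorem CoeffBounds.aemeasurable (h : CoeffBounds a c K) :
    AEMeasurable (fun x => ENNReal.ofReal (1 / a x)) unitVol :=
  ((h.continuousOn_Ioo.aemeasurable measurableSet_Ioo).const_div 1).ennreal_ofReal

theorem CoeffBounds.absolutelyContinuous (h : CoeffBounds a c K) : unitVol ≪ weightVol a := by
  refine withDensity_absolutelyContinuous' h.aemeasurable ?_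
  filter_upwards [ae_restrict_mem measurableSet_Ioo] with x hx
  simpa using h.pos (Ioo_subset_Ioc_self hx)

/-! ### The spaces `L²` and `L²_{1/a}` -/

instance : IsProbabilityMeasure unitVol := ⟨by simp⟩

theorem L2.integrable (f : L2) : Integrable f unitVol :=
  (Lp.memLp f).integrable one_le_two

theorem L2.integral_norm_le (f : L2) : ∫ x in Ioo (0 : ℝ) 1, ‖f x‖ ≤ ‖f‖ := by
  rw [integral_norm_eq_lintegral_enorm (Lp.aestronglyMeasurable f), ← eLpNorm_one_eq_lintegral_enorm,
    Lp.norm_def]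
  exact ENNReal.toReal_mono (Lp.eLpNorm_ne_top f)
    (eLpNorm_le_eLpNorm_of_exponent_le one_le_two (Lp.aestronglyMeasurable f))

theorem norm_sq_eq_integral {μ : Measure ℝ} (f : Lp ℝ 2 μ) : ‖f‖ ^ 2 = ∫ x, f x ^ 2 ∂μ := by
  rw [← real_inner_self_eq_norm_sq, L2.inner_def]
  simp [pow_two]

theorem CoeffBounds.integrable_sq_div (h : CoeffBounds a c K) (p : L2w a) :
    Integrable (fun x => p x ^ 2 / a x) unitVol ∧
      ∫ x in Ioo (0 : ℝ) 1, p x ^ 2 / a x = ‖p‖ ^ 2 := by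
  have e : ∀ᵐ x ∂unitVol, (ENNReal.ofReal (1 / a x)).toReal • p x ^ 2 = p x ^ 2 / a x := by
    filter_upwards [ae_restrict_mem measurableSet_Ioo] with x hx
    rw [ENNReal.toReal_ofReal (by have := h.pos (Ioo_subset_Ioc_self hx); positivity), smul_eq_mul]
    ring
  constructor
  · have h1 : Integrable (fun x => p x ^ 2) (weightVol a) := (Lp.memLp p).integrable_sq
    rw [integrable_withDensity_iff_integrable_smul₀' h.aemeasurable (by simp)] at h1
    exact h1.congr e
  · rw [norm_sq_eq_integral, integral_withDensity_eq_integral_toReal_smul₀ h.aemeasurable (by simp),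
      integral_congr_ae e]

theorem CoeffBounds.sq_mul_div_le (h : CoeffBounds a c K) {x : ℝ} (hx : x ∈ Ioo (0 : ℝ) 1)
    (p : ℝ) : (x * p / a x) ^ 2 ≤ 1 / c * (p ^ 2 / a x) := by
  have hax := h.pos (Ioo_subset_Ioc_self hx)
  have hc := h.c_pos
  have h1 := h.lower x (Ioo_subset_Ioc_self hx)
  have e : 1 / c * (p ^ 2 / a x) - (x * p / a x) ^ 2 =
      p ^ 2 * (a x - c * x ^ 2) / (c * a x ^ 2) := by
    field_simp
  have : 0 ≤ p ^ 2 * (a x - c * x ^ 2) / (c * a x ^ 2) :=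
    div_nonneg (mul_nonneg (sq_nonneg _) (sub_nonneg.mpr h1)) (by positivity)
  linarith

theorem CoeffBounds.memLp (h : CoeffBounds a c K) (p : L2w a) :
    MemLp (fun x => x * p x / a x) 2 unitVol := by
  have hm : AEStronglyMeasurable (fun x => x * p x / a x) unitVol :=
    ((measurable_id.aemeasurable.mul
      ((Lp.aestronglyMeasurable p).mono_ac h.absolutelyContinuous).aemeasurable).div
        (h.continuousOn_Ioo.aemeasurable measurableSet_Ioo)).aestronglyMeasurable
  rw [memLp_two_iff_integrable_sq hm]
  refine ((h.integrable_sq_div p).1.const_mul (1 / c)).mono' (hm.pow 2) ?_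
  filter_upwards [ae_restrict_mem measurableSet_Ioo] with x hx
  rw [Real.norm_of_nonneg (sq_nonneg _)]
  exact h.sq_mul_div_le hx _

/-- The bounded operator `p ↦ x p / a` from `L²_{1/a}` to `L²`. -/
def CoeffBounds.mulDiv (h : CoeffBounds a c K) : L2w a →L[ℝ] L2 :=
  LinearMap.mkContinuous
    { toFun := fun p => (h.memLp p).toLp
      map_add' := fun p p' => by
        rw [← MemLp.toLp_add, MemLp.toLp_eq_toLp_iff]
        filter_upwards [h.absolutelyContinuous.ae_le (Lp.coeFn_add p p')] with x hx
        simp only [Pi.add_apply] at hx ⊢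
        rw [hx]
        ring
      map_smul' := fun r p => by
        rw [RingHom.id_apply, ← MemLp.toLp_const_smul, MemLp.toLp_eq_toLp_iff]
        filter_upwards [h.absolutelyContinuous.ae_le (Lp.coeFn_smul r p)] with x hx
        simp only [Pi.smul_apply, smul_eq_mul] at hx ⊢
        rw [hx]
        ring }
    (Real.sqrt (1 / c)) fun p => by
      have hc : 0 ≤ 1 / c := by have := h.c_pos; positivity
      refine le_of_sq_le_sq ?_ (by positivity)
      rw [mul_pow, Real.sq_sqrt hc, norm_sq_eq_integral, ← (h.integrable_sq_div p).2,
        ← integral_const_mul]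
      refine integral_mono_ae (Lp.memLp _).integrable_sq
        ((h.integrable_sq_div p).1.const_mul _) ?_
      filter_upwards [(h.memLp p).coeFn_toLp, ae_restrict_mem measurableSet_Ioo] with x hx hx'
      simp only [LinearMap.coe_mk, AddHom.coe_mk]
      rw [hx]
      exact h.sq_mul_div_le hx' _

theorem CoeffBounds.coeFn_mulDiv (h : CoeffBounds a c K) (p : L2w a) :
    h.mulDiv p =ᵐ[unitVol] fun x => x * p x / a x := (h.memLp p).coeFn_toLp

/-! ### Representatives of elements of `H²_{1/a}` -/

/-- The continuous representative of `u'`, for `u ∈ H²_{1/a}`. -/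
def slope (u : H2w a) (x : ℝ) : ℝ := ∫ s in (0 : ℝ)..x, weakD2 u s

/-- The continuous representative of `u ∈ H²_{1/a}`. -/
def profile (u : H2w a) (x : ℝ) : ℝ := ∫ s in (0 : ℝ)..x, slope u s

theorem intervalIntegrable_of_unit {f : ℝ → ℝ} (hf : IntegrableOn f (Ioo 0 1)) :
    IntervalIntegrable f volume 0 1 :=
  (intervalIntegrable_iff_integrableOn_Ioo_of_le zero_le_one).mpr hf

theorem continuousOn_primitive_unit {f : ℝ → ℝ} (hf : IntegrableOn f (Ioo 0 1)) :
    ContinuousOn (fun x => ∫ s in (0 : ℝ)..x, f s) (Icc 0 1) := by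
  have h := intervalIntegral.continuousOn_primitive_interval (μ := volume) (f := f) (a := 0) (b := 1)
    (by rw [uIcc_of_le zero_le_one]; exact (integrableOn_Icc_iff_integrableOn_Ioo (by simp) (by simp)).mpr hf)
  rwa [uIcc_of_le zero_le_one] at h

theorem primitive_add_tail {f : ℝ → ℝ} (hf : IntegrableOn f (Ioo 0 1)) {x : ℝ}
    (hx : x ∈ Icc (0 : ℝ) 1) :
    (∫ s in (0 : ℝ)..x, f s) + ∫ s in x..1, f s = ∫ s in (0 : ℝ)..1, f s := by
  have hi := intervalIntegrable_of_unit hf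
  have hx' : x ∈ uIcc (0 : ℝ) 1 := by rwa [uIcc_of_le zero_le_one]
  exact intervalIntegral.integral_add_adjacent_intervals
    (hi.mono_set (uIcc_subset_uIcc_left hx')) (hi.mono_set (uIcc_subset_uIcc_right hx'))

theorem continuousOn_tail_of_integrableOn {f : ℝ → ℝ} (hf : IntegrableOn f (Ioo 0 1)) :
    ContinuousOn (fun x => ∫ s in x..1, f s) (Icc 0 1) := by
  refine ((continuousOn_const (c := ∫ s in (0 : ℝ)..1, f s)).sub
    (continuousOn_primitive_unit hf)).congr fun x hx => ?_
  exact eq_sub_of_add_eq' (primitive_add_tail hf hx)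

theorem eqOn_Icc_of_ae_eq_unit {f g : ℝ → ℝ} (h : f =ᵐ[unitVol] g) (hf : ContinuousOn f (Icc 0 1))
    (hg : ContinuousOn g (Icc 0 1)) : EqOn f g (Icc 0 1) := by
  refine Measure.eqOn_Icc_of_ae_eq volume zero_ne_one ?_ hf hg
  rwa [Measure.restrict_congr_set Ioo_ae_eq_Icc.symm]

/-- A continuous function on `[0,1]` vanishing at both end points is the primitive of its integrable
distributional derivative, which has mean zero. -/
theorem eqOn_primitive {f g : ℝ → ℝ} (hf : ContinuousOn f (Icc 0 1)) (hg : IntegrableOn g (Ioo 0 1))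
    (h0 : f 0 = 0) (h1 : f 1 = 0)
    (h : ∀ φ, IsTestFunction φ →
      ∫ x in Ioo (0 : ℝ) 1, f x * deriv φ x = -∫ x in Ioo (0 : ℝ) 1, g x * φ x) :
    EqOn f (fun x => ∫ s in (0 : ℝ)..x, g s) (Icc 0 1) ∧ ∫ s in (0 : ℝ)..1, g s = 0 := by
  have hfl : LocallyIntegrableOn f (Ioo 0 1) :=
    ((hf.integrableOn_Icc).mono_set Ioo_subset_Icc_self).locallyIntegrableOn
  obtain ⟨d, hd⟩ := ae_eq_const_sub_tail hfl (integrableOn_id_mul hg) h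
  have heq := eqOn_Icc_of_ae_eq_unit hd hf
    (continuousOn_const.sub (continuousOn_tail_of_integrableOn hg))
  have hd0 : d = 0 := by
    have := heq (right_mem_Icc.mpr zero_le_one)
    simpa [h1] using this.symm
  have hz : ∫ s in (0 : ℝ)..1, g s = 0 := by
    have := heq (left_mem_Icc.mpr zero_le_one)
    simpa [h0, hd0] using this
  refine ⟨fun x hx => ?_, hz⟩
  have h2 := primitive_add_tail hg hx
  have h3 := heq hx
  simp only at h3 ⊢
  linarith

theorem continuousOn_slope (u : H2w a) : ContinuousOn (slope u) (Icc 0 1) :=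
  continuousOn_primitive_unit (weakD2 u).integrable

theorem integrableOn_slope (u : H2w a) : IntegrableOn (slope u) (Ioo 0 1) :=
  (continuousOn_slope u).integrableOn_Icc.mono_set Ioo_subset_Icc_self

theorem continuousOn_profile (u : H2w a) : ContinuousOn (profile u) (Icc 0 1) :=
  continuousOn_primitive_unit (integrableOn_slope u)

/-- `profile u` and `slope u` represent `u` and `u'`, and satisfy the boundary conditions at `1`; those
at `0` hold by definition. -/
theorem CoeffBounds.rep_spec (h : CoeffBounds a c K) (u : H2w a) :
    profile u =ᵐ[unitVol] toL2w u ∧ slope u =ᵐ[unitVol] weakD1 u ∧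
      profile u 1 = 0 ∧ slope u 1 = 0 ∧ HasWeakDeriv 2 (profile u) (weakD2 u) := by
  obtain ⟨v, v₁, hv, hv₁, ev, ev₁, d1, d2, v0, v1, v₁0, v₁1⟩ := u.2
  obtain ⟨es, es1⟩ := eqOn_primitive hv₁ (weakD2 u).integrable v₁0 v₁1 (fun φ hφ => by
    have e1 := d1.2.2 _ hφ.deriv
    have e2 := d2.2.2 _ hφ
    rw [iteratedDeriv_one] at e1
    rw [iteratedDeriv_succ, iteratedDeriv_one, e1] at e2
    simp only [pow_one, neg_mul, one_mul, neg_sq, one_pow] at e2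
    rw [weakD2, ← e2, neg_neg])
  have hi₁ : IntegrableOn v₁ (Ioo 0 1) := hv₁.integrableOn_Icc.mono_set Ioo_subset_Icc_self
  obtain ⟨ep, ep1⟩ := eqOn_primitive hv hi₁ v0 v1 (fun φ hφ => by
    have e1 := d1.2.2 _ hφ
    rw [iteratedDeriv_one] at e1
    simpa using e1)
  have es' : EqOn v₁ (slope u) (Icc 0 1) := es
  have epp : EqOn v (profile u) (Icc 0 1) := fun x hx => by
    rw [ep hx]
    refine intervalIntegral.integral_congr fun s hs => es' ?_
    rw [uIcc_of_le hx.1] at hs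
    exact ⟨hs.1, hs.2.trans hx.2⟩
  have toae : ∀ {f g : ℝ → ℝ}, EqOn f g (Icc 0 1) → g =ᵐ[unitVol] f := fun hfg => by
    filter_upwards [ae_restrict_mem measurableSet_Ioo] with x hx
    exact (hfg (Ioo_subset_Icc_self hx)).symm
  refine ⟨(toae epp).trans (h.absolutelyContinuous.ae_le ev), (toae es').trans ev₁, ?_, ?_, ?_⟩
  · rw [← epp (right_mem_Icc.mpr zero_le_one), v1]
  · rw [← es' (right_mem_Icc.mpr zero_le_one), v₁1]
  · refine ⟨?_, d2.2.1, fun φ hφ => ?_⟩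
    · exact ((continuousOn_profile u).integrableOn_Icc.mono_set
        Ioo_subset_Icc_self).locallyIntegrableOn
    · have e2 := d2.2.2 φ hφ
      rw [weakD2, ← e2]
      refine setIntegral_congr_fun measurableSet_Ioo fun x hx => ?_
      rw [epp (Ioo_subset_Icc_self hx)]

theorem norm_primitive_le {f : ℝ → ℝ} (hf : IntegrableOn f (Ioo 0 1)) {x : ℝ}
    (hx : x ∈ Icc (0 : ℝ) 1) : |∫ s in (0 : ℝ)..x, f s| ≤ ∫ s in Ioo (0 : ℝ) 1, ‖f s‖ := by
  refine (intervalIntegral.norm_integral_le_integral_norm (f := f) hx.1).trans ?_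
  rw [intervalIntegral.integral_of_le hx.1, integral_Ioc_eq_integral_Ioo]
  exact setIntegral_mono_set hf.norm (Filter.Eventually.of_forall fun _ => norm_nonneg _)
    (Ioo_subset_Ioo_right hx.2).eventuallyLE

theorem norm_tail_le {f : ℝ → ℝ} (hf : IntegrableOn f (Ioo 0 1)) {x : ℝ}
    (hx : x ∈ Icc (0 : ℝ) 1) : |∫ s in x..1, f s| ≤ ∫ s in Ioo (0 : ℝ) 1, ‖f s‖ := by
  refine (intervalIntegral.norm_integral_le_integral_norm (f := f) hx.2).trans ?_
  rw [intervalIntegral.integral_of_le hx.2, integral_Ioc_eq_integral_Ioo]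
  exact setIntegral_mono_set hf.norm (Filter.Eventually.of_forall fun _ => norm_nonneg _)
    (Ioo_subset_Ioo_left hx.1).eventuallyLE

theorem abs_slope_le (u : H2w a) {x : ℝ} (hx : x ∈ Icc (0 : ℝ) 1) : |slope u x| ≤ ‖u‖ :=
  (norm_primitive_le (weakD2 u).integrable hx).trans <| (weakD2 u).integral_norm_le.trans <|
    (norm_snd_le u.1.2).trans (norm_snd_le u.1)

theorem abs_profile_le (u : H2w a) {x : ℝ} (hx : x ∈ Icc (0 : ℝ) 1) :
    |profile u x| ≤ ‖u‖ * x := by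
  have h1 := intervalIntegral.norm_integral_le_of_norm_le_const (a := 0) (b := x) (f := slope u)
    (C := ‖u‖) (fun s hs => by
      rw [uIoc_of_le hx.1] at hs
      exact abs_slope_le u ⟨hs.1.le, hs.2.trans hx.2⟩)
  rwa [sub_zero, abs_of_nonneg hx.1] at h1

theorem slope_sub (u u' : H2w a) {x : ℝ} (hx : x ∈ Icc (0 : ℝ) 1) :
    slope (u - u') x = slope u x - slope u' x := by
  have hi : ∀ u : H2w a, IntervalIntegrable (weakD2 u) volume 0 x := fun u =>
    (intervalIntegrable_of_unit (weakD2 u).integrable).mono_set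
      (uIcc_subset_uIcc_left (by rwa [uIcc_of_le zero_le_one]))
  rw [slope, slope, slope, ← intervalIntegral.integral_sub (hi u) (hi u')]
  have e : ∀ᵐ s ∂(volume.restrict (Ioo (0 : ℝ) 1)), weakD2 (u - u') s = weakD2 u s - weakD2 u' s :=
    Lp.coeFn_sub (weakD2 u) (weakD2 u')
  rw [Measure.restrict_congr_set Ioo_ae_eq_Ioc, ae_restrict_iff' measurableSet_Ioc] at e
  refine intervalIntegral.integral_congr_ae ?_
  filter_upwards [e] with s hs hs'
  rw [uIoc_of_le hx.1] at hs'
  exact hs ⟨hs'.1, hs'.2.trans hx.2⟩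

theorem profile_sub (u u' : H2w a) {x : ℝ} (hx : x ∈ Icc (0 : ℝ) 1) :
    profile (u - u') x = profile u x - profile u' x := by
  have hi : ∀ u : H2w a, IntervalIntegrable (slope u) volume 0 x := fun u =>
    (intervalIntegrable_of_unit (integrableOn_slope u)).mono_set
      (uIcc_subset_uIcc_left (by rwa [uIcc_of_le zero_le_one]))
  rw [profile, profile, profile, ← intervalIntegral.integral_sub (hi u) (hi u')]
  refine intervalIntegral.integral_congr fun s hs => ?_
  rw [uIcc_of_le hx.1] at hs
  exact slope_sub u u' ⟨hs.1, hs.2.trans hx.2⟩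

theorem hasDerivAt_primitive {f : ℝ → ℝ} (hf : ContinuousOn f (Icc 0 1)) {x : ℝ}
    (hx : x ∈ Ioo (0 : ℝ) 1) : HasDerivAt (fun x => ∫ s in (0 : ℝ)..x, f s) (f x) x := by
  have hn : Icc (0 : ℝ) 1 ∈ nhds x := Icc_mem_nhds hx.1 hx.2
  refine intervalIntegral.integral_hasDerivAt_right ?_
    (hf.mono Ioo_subset_Icc_self |>.stronglyMeasurableAtFilter isOpen_Ioo x hx)
    (hf.continuousAt hn)
  refine (hf.mono ?_).intervalIntegrable
  rw [uIcc_of_le hx.1.le]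
  exact Icc_subset_Icc_right hx.2.le

theorem hasDerivAt_profile (u : H2w a) {x : ℝ} (hx : x ∈ Ioo (0 : ℝ) 1) :
    HasDerivAt (profile u) (slope u x) x := hasDerivAt_primitive (continuousOn_slope u) hx

/-! ### The second derivative of elements of `D(A)` -/

/-- The second-order du Bois-Reymond lemma. -/
theorem ae_eq_affine_of_integral_mul_deriv_deriv_eq_zero {f : ℝ → ℝ}
    (hf : LocallyIntegrableOn f (Ioo 0 1))
    (h : ∀ φ, IsTestFunction φ → ∫ x in Ioo (0 : ℝ) 1, f x * deriv (deriv φ) x = 0) :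
    ∃ α β : ℝ, f =ᵐ[unitVol] fun x => α + β * x := by
  obtain ⟨ρ, hρ, hρ1⟩ := exists_isTestFunction_integral_eq_one
  set m := ∫ x in Ioo (0 : ℝ) 1, f x * deriv ρ x with hm
  have hint : ∀ φ, IsTestFunction φ → IntegrableOn (fun x => f x * deriv φ x) (Ioo 0 1) :=
    fun φ hφ => by
      have := hφ.integrableOn_mul 1 hf
      rwa [iteratedDeriv_one] at this
  -- the distributional derivative of `f` is the constant `-m`
  obtain ⟨d, hd⟩ := ae_eq_const_sub_tail (q := fun _ => -m) hf
    (integrableOn_id_mul (integrableOn_const (by simp))) (fun ψ hψ => by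
      set I := ∫ x in Ioo (0 : ℝ) 1, ψ x with hI
      obtain ⟨φ, hφ, hφd⟩ := (hψ.sub (hρ.smul I)).exists_primitive (by
        simp only [Pi.sub_apply, Pi.smul_apply, smul_eq_mul]
        rw [integral_sub hψ.integrableOn (hρ.integrableOn.const_mul I), integral_const_mul, hρ1,
          ← hI]
        ring)
      have h0 := h φ hφ
      have hdd : ∀ x, deriv (deriv φ) x = deriv ψ x - I * deriv ρ x := fun x => by
        rw [hφd]
        exact ((hψ.hasDerivAt x).sub ((hρ.hasDerivAt x).const_mul I)).deriv
      have e1 : ∀ x, f x * deriv (deriv φ) x = f x * deriv ψ x - I * (f x * deriv ρ x) := fun x => by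
        rw [hdd]
        ring
      simp only [e1] at h0
      rw [integral_sub (hint ψ hψ) ((hint ρ hρ).const_mul I), integral_const_mul, ← hm] at h0
      rw [integral_const_mul, ← hI]
      linarith)
  refine ⟨d + m, -m, ?_⟩
  filter_upwards [hd] with x hx
  rw [hx]
  simp
  ring

/-- `x ↦ ∫ₓ¹ (s - x) q(s) ds`, written as a twice iterated integral; its second derivative is `q`. -/
def doubleTail (q : ℝ → ℝ) (x : ℝ) : ℝ := ∫ s in x..1, ∫ r in s..1, q r

theorem continuousOn_doubleTail {q : ℝ → ℝ} (hq : IntegrableOn (fun x => x * q x) (Ioo 0 1)) :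
    ContinuousOn (doubleTail q) (Icc 0 1) :=
  continuousOn_tail_of_integrableOn (integral_norm_tail_le hq).1

theorem abs_doubleTail_le {q : ℝ → ℝ} (hq : IntegrableOn (fun x => x * q x) (Ioo 0 1)) {x : ℝ}
    (hx : x ∈ Icc (0 : ℝ) 1) : |doubleTail q x| ≤ ∫ x in Ioo (0 : ℝ) 1, ‖x * q x‖ :=
  (norm_tail_le (integral_norm_tail_le hq).1 hx).trans (integral_norm_tail_le hq).2

theorem hasDerivAt_doubleTail {q : ℝ → ℝ} (hq : IntegrableOn (fun x => x * q x) (Ioo 0 1)) {x : ℝ}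
    (hx : x ∈ Ioo (0 : ℝ) 1) : HasDerivAt (doubleTail q) (-∫ r in x..1, q r) x := by
  have hc := continuousOn_tail hq
  refine intervalIntegral.integral_hasDerivAt_left ?_
    (hc.stronglyMeasurableAtFilter isOpen_Ioo x hx) (hc.continuousAt (isOpen_Ioo.mem_nhds hx))
  refine (intervalIntegrable_of_unit (integral_norm_tail_le hq).1).mono_set ?_
  exact uIcc_subset_uIcc_right (by
    rw [uIcc_of_le zero_le_one]
    exact Ioo_subset_Icc_self hx)

theorem integral_weakD2 (h : CoeffBounds a c K) (u : H2w a) :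
    ∫ x in Ioo (0 : ℝ) 1, weakD2 u x = 0 := by
  rw [integral_unit]
  exact (h.rep_spec u).2.2.2.1

theorem integral_id_mul_weakD2 (h : CoeffBounds a c K) (u : H2w a) :
    ∫ x in Ioo (0 : ℝ) 1, x * weakD2 u x = 0 := by
  have h1 := (integral_primitive_mul (b := fun _ => 1) (q := weakD2 u)
    (integrableOn_id_mul (weakD2 u).integrable) continuousOn_const).2
  simp only [intervalIntegral.integral_const, sub_zero, smul_eq_mul, mul_one, one_mul] at h1
  have e : ∀ s ∈ Ioo (0 : ℝ) 1, ∫ x in s..1, weakD2 u x = -slope u s := fun s hs => by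
    have h2 := primitive_add_tail (weakD2 u).integrable (Ioo_subset_Icc_self hs)
    have h3 : ∫ x in (0 : ℝ)..1, weakD2 u x = 0 := (h.rep_spec u).2.2.2.1
    rw [slope]
    linarith
  rw [h1, setIntegral_congr_fun measurableSet_Ioo e, integral_neg, integral_unit]
  exact neg_eq_zero.mpr (h.rep_spec u).2.2.1

/-- For `u ∈ D(A)`, `u''` is the sum of an affine function and of `doubleTail q`, where
`q = u'''' = Au / a`. The boundary conditions `∫₀¹ u'' = ∫₀¹ x u'' = 0` determine the affine part, so
that `u''` is bounded by `∫₀¹ |x q|`, a continuous seminorm of `Au`. -/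
theorem CoeffBounds.exists_curvature (h : CoeffBounds a c K) (u : DomA a) :
    ∃ (q : ℝ → ℝ) (α β : ℝ), (fun x => x * q x) =ᵐ[unitVol] h.mulDiv (opA u) ∧
      IntegrableOn (fun x => x * q x) (Ioo 0 1) ∧
      (fun x => α + β * x + doubleTail q x) =ᵐ[unitVol] weakD2 (toH2w u) ∧
      ∀ x ∈ Icc (0 : ℝ) 1, |α + β * x + doubleTail q x| ≤ 29 * ‖h.mulDiv (opA u)‖ := by
  obtain ⟨v, q, ev, d4, eq⟩ := u.2
  obtain ⟨ep, -, -, -, d2⟩ := h.rep_spec (toH2w u)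
  have hxq : (fun x => x * q x) =ᵐ[unitVol] h.mulDiv (opA u) := by
    filter_upwards [h.coeFn_mulDiv (opA u), h.absolutelyContinuous.ae_le eq,
      ae_restrict_mem measurableSet_Ioo] with x h1 h2 h3
    have h2' : a x * q x = opA u x := h2
    rw [h1, ← h2']
    field_simp [(h.pos (Ioo_subset_Ioc_self h3)).ne']
  have hq : IntegrableOn (fun x => x * q x) (Ioo 0 1) :=
    (h.mulDiv (opA u)).integrable.congr hxq.symm
  have hGc := continuousOn_doubleTail hq
  have hGi : IntegrableOn (doubleTail q) (Ioo 0 1) :=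
    hGc.integrableOn_Icc.mono_set Ioo_subset_Icc_self
  have hwi : IntegrableOn (weakD2 (toH2w u)) (Ioo 0 1) := (weakD2 (toH2w u)).integrable
  have hZi := (integral_norm_tail_le hq).1
  obtain ⟨α, β, hαβ⟩ := ae_eq_affine_of_integral_mul_deriv_deriv_eq_zero
    (f := fun x => weakD2 (toH2w u) x - doubleTail q x)
    (hwi.sub hGi).locallyIntegrableOn (fun φ hφ => by
      have i1 := hφ.deriv.integrableOn_mul 1 hwi.locallyIntegrableOn
      have i2 := hφ.deriv.integrableOn_mul 1 hGi.locallyIntegrableOn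
      rw [iteratedDeriv_one] at i1 i2
      simp only [sub_mul]
      rw [integral_sub i1 i2]
      have e4 := d4.2.2 φ hφ
      have e2 := d2.2.2 _ hφ.deriv.deriv
      have ed : iteratedDeriv 4 φ = iteratedDeriv 2 (deriv (deriv φ)) := by
        rw [iteratedDeriv_succ', iteratedDeriv_succ']
      have evp : ∫ x in Ioo (0 : ℝ) 1, v x * iteratedDeriv 4 φ x =
          ∫ x in Ioo (0 : ℝ) 1, profile (toH2w u) x * iteratedDeriv 2 (deriv (deriv φ)) x := by
        refine integral_congr_ae ?_
        filter_upwards [h.absolutelyContinuous.ae_le ev, ep] with x h1 h2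
        rw [ed, h2]
        exact congrArg (· * _) h1
      rw [evp, e2] at e4
      have e5 := hφ.deriv.integral_deriv_mul_tail (integrableOn_id_mul hZi)
      have e6 := hφ.integral_deriv_mul_tail hq
      have e7 : ∀ x, doubleTail q x * deriv (deriv φ) x =
          deriv (deriv φ) x * ∫ s in x..1, ∫ r in s..1, q r := fun x => mul_comm _ _
      simp only [e7]
      rw [e5, e6]
      norm_num at e4
      rw [e4, sub_eq_zero]
      simp only [mul_comm])
  have hw : (fun x => α + β * x + doubleTail q x) =ᵐ[unitVol] weakD2 (toH2w u) := by
    filter_upwards [hαβ] with x hx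
    rw [← hx]
    ring
  refine ⟨q, α, β, hxq, hq, hw, ?_⟩
  set M := ∫ x in Ioo (0 : ℝ) 1, ‖x * q x‖ with hM
  have hMle : M ≤ ‖h.mulDiv (opA u)‖ := by
    have e : M = ∫ x in Ioo (0 : ℝ) 1, ‖h.mulDiv (opA u) x‖ := by
      refine integral_congr_ae ?_
      filter_upwards [hxq] with x hx
      exact congrArg norm hx
    rw [e]
    exact L2.integral_norm_le _
  have hGx := integrableOn_id_mul hGi
  have b0 : |∫ x in Ioo (0 : ℝ) 1, doubleTail q x| ≤ M := by
    have := norm_setIntegral_le_of_norm_le_const (μ := volume) (s := Ioo (0 : ℝ) 1)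
      (f := doubleTail q) (C := M) (by simp)
      (fun x hx => abs_doubleTail_le hq (Ioo_subset_Icc_self hx))
    simpa using this
  have b1 : |∫ x in Ioo (0 : ℝ) 1, x * doubleTail q x| ≤ M := by
    have := norm_setIntegral_le_of_norm_le_const (μ := volume) (s := Ioo (0 : ℝ) 1)
      (f := fun x => x * doubleTail q x) (C := M) (by simp)
      (fun x hx => by
        rw [norm_mul, Real.norm_of_nonneg hx.1.le]
        exact (mul_le_of_le_one_left (norm_nonneg _) hx.2.le).trans
          (abs_doubleTail_le hq (Ioo_subset_Icc_self hx)))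
    simpa using this
  have m0 : α + β / 2 + ∫ x in Ioo (0 : ℝ) 1, doubleTail q x = 0 := by
    have e := integral_congr_ae hw
    rw [integral_weakD2 h, integral_add (f := fun x => α + β * x)
      ((continuousOn_const.add (continuousOn_const.mul continuousOn_id)).integrableOn_Icc.mono_set
        Ioo_subset_Icc_self) hGi] at e
    have e0 : ∫ x in Ioo (0 : ℝ) 1, (α + β * x) = α + β / 2 := by
      rw [integral_unit, intervalIntegral.integral_add
        (Continuous.intervalIntegrable (by fun_prop) _ _)
        (Continuous.intervalIntegrable (by fun_prop) _ _), intervalIntegral.integral_const_mul]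
      simp
      ring
    rwa [e0] at e
  have m1 : α / 2 + β / 3 + ∫ x in Ioo (0 : ℝ) 1, x * doubleTail q x = 0 := by
    have hw' : (fun x => (α * x + β * x ^ 2) + x * doubleTail q x) =ᵐ[unitVol]
        fun x => x * weakD2 (toH2w u) x := by
      filter_upwards [hw] with x hx
      rw [← hx]
      ring
    have e := integral_congr_ae hw'
    have hp : Continuous fun x : ℝ => α * x + β * x ^ 2 := by fun_prop
    rw [integral_id_mul_weakD2 h, integral_add (f := fun x => α * x + β * x ^ 2)
      (hp.continuousOn.integrableOn_Icc.mono_set Ioo_subset_Icc_self) hGx] at e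
    have e0 : ∫ x in Ioo (0 : ℝ) 1, (α * x + β * x ^ 2) = α / 2 + β / 3 := by
      rw [integral_unit, intervalIntegral.integral_add
        (Continuous.intervalIntegrable (by fun_prop) _ _)
        (Continuous.intervalIntegrable (by fun_prop) _ _), intervalIntegral.integral_const_mul,
        intervalIntegral.integral_const_mul, integral_id, integral_pow]
      norm_num
      ring
    rwa [e0] at e
  intro x hx
  have b2 := abs_doubleTail_le hq hx
  rw [abs_le] at b0 b1 b2
  -- solving `m0`, `m1` gives `|β| ≤ 18 M` and `|α| ≤ 10 M`, hence the constant `29 = 10 + 18 + 1`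
  have hβ : |β| ≤ 18 * M := abs_le.mpr ⟨by linarith [b0.1, b1.1, b0.2, b1.2],
    by linarith [b0.1, b1.1, b0.2, b1.2]⟩
  have hβx : |β * x| ≤ 18 * M := by
    rw [abs_mul, abs_of_nonneg hx.1]
    exact (mul_le_of_le_one_right (abs_nonneg _) hx.2).trans hβ
  rw [abs_le] at hβ hβx
  rw [abs_le]
  constructor <;> linarith [b0.1, b1.1, b0.2, b1.2, b2.1, b2.2, hβx.1, hβx.2, hβ.1, hβ.2]

/-- The fundamental theorem of calculus on `(0,1)`. -/
theorem integral_unit_eq_sub {f f' : ℝ → ℝ} (hf : ContinuousOn f (Icc 0 1))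
    (hd : ∀ x ∈ Ioo (0 : ℝ) 1, HasDerivAt f (f' x) x) (hi : IntegrableOn f' (Ioo 0 1)) :
    ∫ x in Ioo (0 : ℝ) 1, f' x = f 1 - f 0 := by
  rw [integral_unit]
  exact intervalIntegral.integral_eq_sub_of_hasDerivAt_of_le zero_le_one hf hd
    (intervalIntegrable_of_unit hi)

/-! ### The two stationary identities -/

/-- `∫₀¹ x u' u'''' = 3/2 ∫₀¹ u''² - 1/2 u''(1)²` for `u ∈ D(A)`, where `w` stands for the continuous
representative of `u''`. -/
theorem CoeffBounds.inner_opA_slope (h : CoeffBounds a c K) (u : DomA a) {w : ℝ → ℝ}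
    (hwc : ContinuousOn w (Icc 0 1)) (hw : w =ᵐ[unitVol] weakD2 (toH2w u)) :
    inner ℝ (h.mulDiv (opA u)) (weakD1 (toH2w u)) =
      3 / 2 * (∫ x in Ioo (0 : ℝ) 1, w x ^ 2) - 1 / 2 * w 1 ^ 2 := by
  obtain ⟨q, α, β, hxq, hq, hw', -⟩ := h.exists_curvature u
  have hW := eqOn_Icc_of_ae_eq_unit (hw.trans hw'.symm) hwc
    ((continuousOn_const.add (continuousOn_const.mul continuousOn_id)).add
      (continuousOn_doubleTail hq))
  set σ := slope (toH2w u) with hσ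
  have hσc : ContinuousOn σ (Icc 0 1) := continuousOn_slope _
  obtain ⟨-, eσ, -, hσ1, -⟩ := h.rep_spec (toH2w u)
  have hσ0 : σ 0 = 0 := by simp [hσ, slope]
  have hσeq : EqOn σ (fun x => ∫ s in (0 : ℝ)..x, w s) (Icc 0 1) := fun x hx => by
    have hw1 : ∀ᵐ x ∂(volume.restrict (Ioo (0 : ℝ) 1)), w x = weakD2 (toH2w u) x := hw
    rw [Measure.restrict_congr_set Ioo_ae_eq_Ioc, ae_restrict_iff' measurableSet_Ioc] at hw1
    refine intervalIntegral.integral_congr_ae ?_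
    filter_upwards [hw1] with s hs hs'
    rw [uIoc_of_le hx.1] at hs'
    exact (hs ⟨hs'.1, hs'.2.trans hx.2⟩).symm
  have hσd : ∀ x ∈ Ioo (0 : ℝ) 1, HasDerivAt σ (w x) x := fun x hx =>
    (hasDerivAt_primitive hwc hx).congr_of_eventuallyEq
      (hσeq.eventuallyEq_of_mem (Icc_mem_nhds hx.1 hx.2))
  have hwd : ∀ x ∈ Ioo (0 : ℝ) 1, HasDerivAt w (β - ∫ r in x..1, q r) x := fun x hx => by
    have h1 : HasDerivAt (fun x => α + β * x + doubleTail q x) (β + -∫ r in x..1, q r) x := by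
      have h2 : HasDerivAt (fun x : ℝ => α + β * x) β x := by
        simpa using ((hasDerivAt_id x).const_mul β).const_add α
      exact h2.add (hasDerivAt_doubleTail hq hx)
    rw [← sub_eq_add_neg] at h1
    exact h1.congr_of_eventuallyEq (hW.eventuallyEq_of_mem (Icc_mem_nhds hx.1 hx.2))
  have hbc : ContinuousOn (fun x => σ x + x * w x) (Icc 0 1) := hσc.add (continuousOn_id.mul hwc)
  have hprim : ∀ x ∈ Icc (0 : ℝ) 1, ∫ s in (0 : ℝ)..x, (σ s + s * w s) = x * σ x := fun x hx => by
    have h1 := intervalIntegral.integral_eq_sub_of_hasDerivAt_of_le hx.1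
      (f := fun s => s * σ s) (f' := fun s => σ s + s * w s)
      ((continuousOn_id.mul hσc).mono (Icc_subset_Icc_right hx.2))
      (fun s hs => by
        refine ((hasDerivAt_id s).mul (hσd s ⟨hs.1, hs.2.trans_le hx.2⟩)).congr_deriv ?_
        simp)
      ((hbc.mono (by rw [uIcc_of_le hx.1]; exact Icc_subset_Icc_right hx.2)).intervalIntegrable)
    rw [h1]
    simp
  obtain ⟨hbZ, hswap⟩ := integral_primitive_mul hq hbc
  have hinner : inner ℝ (h.mulDiv (opA u)) (weakD1 (toH2w u)) =
      ∫ x in Ioo (0 : ℝ) 1, (∫ s in (0 : ℝ)..x, (σ s + s * w s)) * q x := by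
    rw [L2.inner_def]
    refine integral_congr_ae ?_
    filter_upwards [hxq, eσ, ae_restrict_mem measurableSet_Ioo] with x h1 h2 h3
    rw [hprim x (Ioo_subset_Icc_self h3), ← h1, ← h2]
    simp
    ring
  rw [hinner, hswap]
  have hw2 : IntegrableOn (fun x => w x ^ 2) (Ioo 0 1) :=
    (hwc.pow 2).integrableOn_Icc.mono_set Ioo_subset_Icc_self
  -- with `Z = ∫ₛ¹ q = β - w'`, an antiderivative of `(x σ)' Z - 3/2 w²`
  have hfin := integral_unit_eq_sub
    (f := fun x => β * (x * σ x) - (σ x * w x + x * w x ^ 2 / 2))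
    (f' := fun x => (σ x + x * w x) * (∫ r in x..1, q r) - 3 / 2 * w x ^ 2)
    ((continuousOn_const.mul (continuousOn_id.mul hσc)).sub
      ((hσc.mul hwc).add ((continuousOn_id.mul (hwc.pow 2)).div_const 2)))
    (fun x hx => by
      have h1 := hσd x hx
      have h2 := hwd x hx
      have h3 := (((hasDerivAt_id x).mul h1).const_mul β).sub
        ((h1.mul h2).add (((hasDerivAt_id x).mul (h2.pow 2)).div_const 2))
      refine h3.congr_deriv ?_
      simp
      ring)
    (hbZ.sub (hw2.const_mul _))
  rw [integral_sub hbZ (hw2.const_mul _), integral_const_mul, hσ0, hσ, hσ1] at hfin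
  linarith

theorem CoeffBounds.div_le (h : CoeffBounds a c K) {x C D r s : ℝ} (hx : x ∈ Ioc (0 : ℝ) 1)
    (hr : |r| ≤ C * x) (hs : |s| ≤ D * x) : |r * s / a x| ≤ C * D / c := by
  have hax := h.pos hx
  have hc := h.c_pos
  have hx0 := hx.1.le
  have hC : 0 ≤ C := nonneg_of_mul_nonneg_left ((abs_nonneg _).trans hr) hx.1
  have hD : 0 ≤ D := nonneg_of_mul_nonneg_left ((abs_nonneg _).trans hs) hx.1
  rw [abs_div, abs_mul, abs_of_pos hax, div_le_div_iff₀ hax hc]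
  calc |r| * |s| * c ≤ C * x * (D * x) * c := by gcongr
    _ = C * D * (c * x ^ 2) := by ring
    _ ≤ C * D * a x := by gcongr; exact h.lower x hx

theorem CoeffBounds.abs_weighted_sq_le (h : CoeffBounds a c K) (u : H2w a) {x : ℝ}
    (hx : x ∈ Ioo (0 : ℝ) 1) :
    |profile u x ^ 2 / a x * (1 - x * coeffDeriv a x / a x)| ≤ ‖u‖ * ‖u‖ / c * (1 + K) := by
  have h1 := abs_profile_le u (Ioo_subset_Icc_self hx)
  rw [abs_mul, pow_two]
  refine mul_le_mul (h.div_le (Ioo_subset_Ioc_self hx) h1 h1) ?_ (abs_nonneg _)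
    (div_nonneg (mul_self_nonneg _) h.c_pos.le)
  refine (abs_sub _ _).trans ?_
  rw [abs_one]
  linarith [h.abs_deriv_le x hx]

theorem CoeffBounds.abs_profile_mul_slope_le (h : CoeffBounds a c K) (u u' : H2w a) {x : ℝ}
    (hx : x ∈ Ioo (0 : ℝ) 1) :
    |x * profile u x * slope u' x / a x| ≤ ‖u‖ * ‖u'‖ / c := by
  have hx' := Ioo_subset_Icc_self hx
  have h1 := h.div_le (Ioo_subset_Ioc_self hx) (s := x * slope u' x) (D := ‖u'‖)
    (abs_profile_le u hx') (by
      rw [abs_mul, abs_of_pos hx.1, mul_comm]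
      exact mul_le_mul_of_nonneg_right (abs_slope_le u' hx') hx.1.le)
  convert h1 using 3
  ring

theorem CoeffBounds.continuousOn_factor (h : CoeffBounds a c K) :
    ContinuousOn (fun x => 1 - x * coeffDeriv a x / a x) (Ioo 0 1) :=
  continuousOn_const.sub ((continuousOn_id.mul h.continuousOn_deriv).div h.continuousOn_Ioo
    fun _ hx => (h.pos (Ioo_subset_Ioc_self hx)).ne')

theorem CoeffBounds.integrableOn_profile_mul_slope (h : CoeffBounds a c K) (u u' : H2w a) :
    IntegrableOn (fun x => x * profile u x * slope u' x / a x) (Ioo 0 1) := by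
  refine Integrable.mono' (g := fun _ => ‖u‖ * ‖u'‖ / c) (integrableOn_const (by simp))
    ((((continuousOn_id.mul ((continuousOn_profile u).mono Ioo_subset_Icc_self)).mul
      ((continuousOn_slope u').mono Ioo_subset_Icc_self)).div h.continuousOn_Ioo
        fun _ hx => (h.pos (Ioo_subset_Ioc_self hx)).ne').aestronglyMeasurable
          measurableSet_Ioo) ?_
  filter_upwards [ae_restrict_mem measurableSet_Ioo] with x hx
  exact h.abs_profile_mul_slope_le u u' hx

theorem CoeffBounds.inner_eq_integral (h : CoeffBounds a c K) (u u' : H2w a) :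
    inner ℝ (h.mulDiv (toL2w u)) (weakD1 u') =
      ∫ x in Ioo (0 : ℝ) 1, x * profile u x * slope u' x / a x := by
  rw [L2.inner_def]
  refine integral_congr_ae ?_
  filter_upwards [h.coeFn_mulDiv (toL2w u), (h.rep_spec u).1, (h.rep_spec u').2.1] with x h1 h2 h3
  rw [h1, ← h2, ← h3]
  simp
  ring

/-- `∫₀¹ x v v' / a = -1/2 ∫₀¹ (x/a)' v²` for `v ∈ H²_{1/a}`. The boundary term `x v² / a` tends to
`0` at `0`, since `v = O(x)` and `a ≥ c x²`. -/
theorem CoeffBounds.inner_toL2w_slope (h : CoeffBounds a c K) (u : H2w a) :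
    inner ℝ (h.mulDiv (toL2w u)) (weakD1 u) =
      -(1 / 2 * ∫ x in Ioo (0 : ℝ) 1, profile u x ^ 2 / a x * (1 - x * coeffDeriv a x / a x)) := by
  have hpc := (continuousOn_profile u).mono Ioo_subset_Icc_self
  have hane : ∀ x ∈ Ioc (0 : ℝ) 1, a x ≠ 0 := fun x hx => (h.pos hx).ne'
  have hi1 := h.integrableOn_profile_mul_slope u u
  have hi2 : IntegrableOn
      (fun x => profile u x ^ 2 / a x * (1 - x * coeffDeriv a x / a x)) (Ioo 0 1) := by
    refine Integrable.mono' (g := fun _ => ‖u‖ * ‖u‖ / c * (1 + K)) (integrableOn_const (by simp))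
      ((((hpc.pow 2).div h.continuousOn_Ioo fun x hx => hane x (Ioo_subset_Ioc_self hx)).mul
        h.continuousOn_factor).aestronglyMeasurable measurableSet_Ioo) ?_
    filter_upwards [ae_restrict_mem measurableSet_Ioo] with x hx
    exact h.abs_weighted_sq_le u hx
  have hfc : ContinuousOn (fun x => x * profile u x ^ 2 / a x) (Icc 0 1) := by
    have hb : ∀ x ∈ Icc (0 : ℝ) 1, ‖x * profile u x ^ 2 / a x‖ ≤ x * (‖u‖ * ‖u‖ / c) := by
      intro x hx
      rcases hx.1.eq_or_lt with rfl | h0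
      · simp
      · have h1 := h.div_le ⟨h0, hx.2⟩ (abs_profile_le u hx) (abs_profile_le u hx)
        rw [mul_div_assoc, norm_mul, Real.norm_of_nonneg hx.1, pow_two]
        exact mul_le_mul_of_nonneg_left h1 hx.1
    intro x hx
    rcases hx.1.eq_or_lt with rfl | h0
    · have hlim : Filter.Tendsto (fun x : ℝ => x * (‖u‖ * ‖u‖ / c)) (nhdsWithin 0 (Icc 0 1))
          (nhds 0) := by
        have : Continuous fun x : ℝ => x * (‖u‖ * ‖u‖ / c) := by fun_prop
        simpa using (this.tendsto 0).mono_left nhdsWithin_le_nhds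
      rw [ContinuousWithinAt, zero_mul, zero_div]
      exact squeeze_zero_norm' (by filter_upwards [self_mem_nhdsWithin] with x hx using hb x hx) hlim
    · have h1 : ContinuousWithinAt (fun x => x * profile u x ^ 2 / a x) (Ioc 0 1) x :=
        ((continuousOn_id.mul (((continuousOn_profile u).mono Ioc_subset_Icc_self).pow 2)).div
          h.continuousOn hane) x ⟨h0, hx.2⟩
      refine h1.mono_of_mem_nhdsWithin ?_
      filter_upwards [self_mem_nhdsWithin, mem_nhdsWithin_of_mem_nhds (Ioi_mem_nhds h0)]
        with t h2 h3 using ⟨h3, h2.2⟩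
  have hsum : IntegrableOn (fun x => 2 * (x * profile u x * slope u x / a x) +
      profile u x ^ 2 / a x * (1 - x * coeffDeriv a x / a x)) (Ioo 0 1) :=
    (hi1.const_mul 2).add hi2
  have hfin := integral_unit_eq_sub hfc (f' := fun x => 2 * (x * profile u x * slope u x / a x) +
        profile u x ^ 2 / a x * (1 - x * coeffDeriv a x / a x)) (fun x hx => by
      have hax := hane x (Ioo_subset_Ioc_self hx)
      refine (((hasDerivAt_id x).mul ((hasDerivAt_profile u hx).pow 2)).div
        (h.hasDerivAt x hx) hax).congr_deriv ?_
      simp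
      field_simp
      ring) hsum
  rw [integral_add (hi1.const_mul 2) hi2, integral_const_mul, (h.rep_spec u).2.2.1] at hfin
  rw [h.inner_eq_integral]
  simp only [ne_eq, OfNat.ofNat_ne_zero, not_false_eq_true, zero_pow, mul_zero, zero_div, zero_mul,
    sub_zero] at hfin
  linarith

/-! ### Dependence on time -/

/-- If the representative `R u` is continuous on `[0,1]` and depends Lipschitz continuously on `u`,
uniformly in `x`, then it is jointly continuous along a continuous curve `t ↦ f t`. -/
theorem continuousOn_rep {X : Type*} [SeminormedAddCommGroup X] {f : ℝ → X}
    (hf : ContinuousOn f (Ici 0)) {R : X → ℝ → ℝ} {C : ℝ} (hc : ∀ u, ContinuousOn (R u) (Icc 0 1))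
    (hR : ∀ u u', ∀ x ∈ Icc (0 : ℝ) 1, |R u x - R u' x| ≤ C * ‖u - u'‖) :
    ContinuousOn (fun p : ℝ × ℝ => R (f p.1) p.2) (Ici 0 ×ˢ Icc 0 1) := by
  rintro ⟨t, x⟩ ⟨ht, hx⟩
  have h1 : Filter.Tendsto (fun p : ℝ × ℝ => C * ‖f p.1 - f t‖)
      (nhdsWithin (t, x) (Ici 0 ×ˢ Icc 0 1)) (nhds 0) := by
    have h2 : ContinuousWithinAt (fun p : ℝ × ℝ => f p.1) (Ici 0 ×ˢ Icc 0 1) (t, x) :=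
      (hf t ht).comp continuousWithinAt_fst fun p hp => hp.1
    have h3 := ((h2.sub (continuousWithinAt_const (b := f t))).norm.const_mul C).tendsto
    simpa using h3
  have h4 : Filter.Tendsto (fun p : ℝ × ℝ => |R (f t) p.2 - R (f t) x|)
      (nhdsWithin (t, x) (Ici 0 ×ˢ Icc 0 1)) (nhds 0) := by
    have h2 : ContinuousWithinAt (fun p : ℝ × ℝ => R (f t) p.2) (Ici 0 ×ˢ Icc 0 1) (t, x) :=
      (hc (f t) x hx).comp continuousWithinAt_snd fun p hp => hp.2
    have h3 := (h2.sub (continuousWithinAt_const (b := R (f t) x))).abs.tendsto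
    simpa using h3
  refine tendsto_iff_dist_tendsto_zero.mpr
    (squeeze_zero' (Filter.Eventually.of_forall fun _ => dist_nonneg) ?_
      (by simpa using h1.add h4))
  filter_upwards [self_mem_nhdsWithin] with p hp
  rw [Real.dist_eq]
  exact (abs_sub_le _ (R (f t) p.2) _).trans (add_le_add (hR _ _ _ hp.2) le_rfl)

/-- `toL2w` as a continuous linear map. -/
def toL2wL (a : ℝ → ℝ) : H2w a →L[ℝ] L2w a :=
  (ContinuousLinearMap.fst ℝ (L2w a) (L2 × L2)).comp (H2w a).subtypeL

/-- `weakD1` as a continuous linear map. -/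
def weakD1L (a : ℝ → ℝ) : H2w a →L[ℝ] L2 :=
  ((ContinuousLinearMap.fst ℝ L2 L2).comp (ContinuousLinearMap.snd ℝ (L2w a) (L2 × L2))).comp
    (H2w a).subtypeL

/-- `opA` as a continuous linear map. -/
def opAL (a : ℝ → ℝ) : DomA a →L[ℝ] L2w a :=
  (ContinuousLinearMap.snd ℝ (H2w a) (L2w a)).comp (DomA a).subtypeL

section Solution

variable {y₀ : DomA a} {y₁ : H2w a} {y : ℝ → DomA a}

theorem IsClassicalSolution.hasDerivWithinAt_toH2w (hy : IsClassicalSolution a y₀ y₁ y) {t : ℝ}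
    (ht : t ∈ Ici (0 : ℝ)) :
    HasDerivWithinAt (fun s => toH2w (y s)) (timeDeriv y t) (Ici 0) t :=
  (hy.contDiffOn_H2w.differentiableOn one_ne_zero t ht).hasDerivWithinAt

theorem IsClassicalSolution.continuousOn_timeDeriv (hy : IsClassicalSolution a y₀ y₁ y) :
    ContinuousOn (timeDeriv y) (Ici 0) :=
  hy.contDiffOn_H2w.continuousOn_derivWithin (uniqueDiffOn_Ici 0) le_rfl

/-- The equation `y_tt = -A y`, read as a statement about the derivative of `y_t` in `L²_{1/a}`. -/
theorem IsClassicalSolution.hasDerivWithinAt_timeDeriv (hy : IsClassicalSolution a y₀ y₁ y) {t : ℝ}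
    (ht : t ∈ Ici (0 : ℝ)) :
    HasDerivWithinAt (fun s => toL2w (timeDeriv y s)) (-opA (y t)) (Ici 0) t := by
  set g : ℝ → L2w a := fun s => toL2w (toH2w (y s)) with hg
  have h1 : ∀ s ∈ Ici (0 : ℝ), toL2w (timeDeriv y s) = derivWithin g (Ici 0) s := fun s hs => by
    have := (toL2wL a).hasFDerivAt.comp_hasDerivWithinAt s (hy.hasDerivWithinAt_toH2w hs)
    exact (this.derivWithin (uniqueDiffOn_Ici 0 s hs)).symm
  have h2 : DifferentiableOn ℝ (derivWithin g (Ici 0)) (Ici 0) :=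
    (hy.contDiffOn_L2w.derivWithin (m := 1) (uniqueDiffOn_Ici 0)
      (by norm_num)).differentiableOn one_ne_zero
  have h3 := (h2 t ht).hasDerivWithinAt
  have h4 := eq_neg_of_add_eq_zero_left (hy.equation t ht)
  rw [iteratedDerivWithin_succ, iteratedDerivWithin_one] at h4
  rw [← h4]
  exact h3.congr h1 (h1 t ht)

/-- The derivative of `∫₀¹ x y_t y_x / a dx`. -/
theorem IsClassicalSolution.hasDerivWithinAt_inner (hy : IsClassicalSolution a y₀ y₁ y)
    (h : CoeffBounds a c K) {t : ℝ} (ht : t ∈ Ici (0 : ℝ)) :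
    HasDerivWithinAt
      (fun s => inner ℝ (h.mulDiv (toL2w (timeDeriv y s))) (weakD1 (toH2w (y s))))
      (inner ℝ (h.mulDiv (toL2w (timeDeriv y t))) (weakD1 (timeDeriv y t)) -
        inner ℝ (h.mulDiv (opA (y t))) (weakD1 (toH2w (y t)))) (Ici 0) t := by
  have h1 := h.mulDiv.hasFDerivAt.comp_hasDerivWithinAt t (hy.hasDerivWithinAt_timeDeriv ht)
  have h2 := (weakD1L a).hasFDerivAt.comp_hasDerivWithinAt t (hy.hasDerivWithinAt_toH2w ht)
  have h3 := h1.inner ℝ h2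
  refine h3.congr_deriv ?_
  rw [map_neg, inner_neg_left, ← sub_eq_add_neg]
  rfl

theorem IsClassicalSolution.integral_deriv_inner (hy : IsClassicalSolution a y₀ y₁ y)
    (h : CoeffBounds a c K) {T : ℝ} (hT : 0 < T) :
    ∫ t in Ioo 0 T, (inner ℝ (h.mulDiv (toL2w (timeDeriv y t))) (weakD1 (timeDeriv y t)) -
        inner ℝ (h.mulDiv (opA (y t))) (weakD1 (toH2w (y t)))) =
      inner ℝ (h.mulDiv (toL2w (timeDeriv y T))) (weakD1 (toH2w (y T))) -
        inner ℝ (h.mulDiv (toL2w (timeDeriv y 0))) (weakD1 (toH2w (y 0))) := by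
  have hc1 : ContinuousOn (fun t => h.mulDiv (toL2w (timeDeriv y t))) (Ici 0) :=
    (h.mulDiv.comp (toL2wL a)).continuous.comp_continuousOn hy.continuousOn_timeDeriv
  have hc2 : ContinuousOn (fun t => weakD1 (timeDeriv y t)) (Ici 0) :=
    (weakD1L a).continuous.comp_continuousOn hy.continuousOn_timeDeriv
  have hc3 : ContinuousOn (fun t => h.mulDiv (opA (y t))) (Ici 0) :=
    (h.mulDiv.comp (opAL a)).continuous.comp_continuousOn hy.continuousOn_DomA
  have hc4 : ContinuousOn (fun t => weakD1 (toH2w (y t))) (Ici 0) :=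
    (weakD1L a).continuous.comp_continuousOn hy.contDiffOn_H2w.continuousOn
  rw [← integral_Ioc_eq_integral_Ioo, ← intervalIntegral.integral_of_le hT.le]
  refine intervalIntegral.integral_eq_sub_of_hasDerivAt_of_le hT.le
    (f := fun s => inner ℝ (h.mulDiv (toL2w (timeDeriv y s))) (weakD1 (toH2w (y s))))
    ((hc1.inner hc4).mono Icc_subset_Ici_self)
    (fun t ht => (hy.hasDerivWithinAt_inner h ht.1.le).hasDerivAt (Ici_mem_nhds ht.1)) ?_
  refine (((hc1.inner hc2).sub (hc3.inner hc4)).mono ?_).intervalIntegrable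
  rw [uIcc_of_le hT.le]
  exact Icc_subset_Ici_self

end Solution

theorem CoeffBounds.exists_continuous_curvature (h : CoeffBounds a c K) (u : DomA a) :
    ∃ w : ℝ → ℝ, ContinuousOn w (Icc 0 1) ∧ w =ᵐ[unitVol] weakD2 (toH2w u) ∧
      ∀ x ∈ Icc (0 : ℝ) 1, |w x| ≤ 29 * ‖h.mulDiv (opA u)‖ := by
  obtain ⟨q, α, β, -, hq, hw, hb⟩ := h.exists_curvature u
  exact ⟨_, (continuousOn_const.add (continuousOn_const.mul continuousOn_id)).add
    (continuousOn_doubleTail hq), hw, hb⟩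

/-- The continuous representative of `u''`, for `u ∈ D(A)`. -/
def CoeffBounds.curvature (h : CoeffBounds a c K) (u : DomA a) : ℝ → ℝ :=
  (h.exists_continuous_curvature u).choose

theorem CoeffBounds.continuousOn_curvature (h : CoeffBounds a c K) (u : DomA a) :
    ContinuousOn (h.curvature u) (Icc 0 1) :=
  (h.exists_continuous_curvature u).choose_spec.1

theorem CoeffBounds.curvature_ae_eq (h : CoeffBounds a c K) (u : DomA a) :
    h.curvature u =ᵐ[unitVol] weakD2 (toH2w u) :=
  (h.exists_continuous_curvature u).choose_spec.2.1

theorem CoeffBounds.abs_curvature_sub_le (h : CoeffBounds a c K) (u u' : DomA a) {x : ℝ}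
    (hx : x ∈ Icc (0 : ℝ) 1) :
    |h.curvature u x - h.curvature u' x| ≤ 29 * ‖h.mulDiv‖ * ‖u - u'‖ := by
  have hs : ∀ᵐ x ∂unitVol, weakD2 (toH2w (u - u')) x = weakD2 (toH2w u) x - weakD2 (toH2w u') x :=
    Lp.coeFn_sub (weakD2 (toH2w u)) (weakD2 (toH2w u'))
  -- the continuous representative is unique, hence additive
  have e : EqOn (h.curvature (u - u')) (fun x => h.curvature u x - h.curvature u' x) (Icc 0 1) := by
    refine eqOn_Icc_of_ae_eq_unit ?_ (h.continuousOn_curvature _)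
      ((h.continuousOn_curvature u).sub (h.continuousOn_curvature u'))
    filter_upwards [h.curvature_ae_eq (u - u'), h.curvature_ae_eq u, h.curvature_ae_eq u', hs]
      with x h1 h2 h3 h4
    rw [h1, h2, h3, h4]
  have ex : h.curvature (u - u') x = h.curvature u x - h.curvature u' x := e hx
  rw [← ex, mul_assoc]
  refine ((h.exists_continuous_curvature (u - u')).choose_spec.2.2 x hx).trans ?_
  have hop : ‖opA (u - u')‖ ≤ ‖u - u'‖ := norm_snd_le (u - u').1
  have := (h.mulDiv.le_opNorm (opA (u - u'))).trans
    (mul_le_mul_of_nonneg_left hop (norm_nonneg _))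
  linarith

theorem isContinuousRep_profile (h : CoeffBounds a c K) {f : ℝ → H2w a}
    (hf : ContinuousOn f (Ici 0)) :
    IsContinuousRep (fun t => profile (f t)) (fun t => toL2w (f t)) := by
  refine ⟨continuousOn_rep hf (C := 1) continuousOn_profile fun u u' x hx => ?_,
    fun t _ => (h.rep_spec (f t)).1⟩
  rw [← profile_sub u u' hx, one_mul]
  exact (abs_profile_le _ hx).trans (mul_le_of_le_one_right (norm_nonneg _) hx.2)

theorem isContinuousRep_slope (h : CoeffBounds a c K) {f : ℝ → H2w a}
    (hf : ContinuousOn f (Ici 0)) :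
    IsContinuousRep (fun t => slope (f t)) (fun t => weakD1 (f t)) := by
  refine ⟨continuousOn_rep hf (C := 1) continuousOn_slope fun u u' x hx => ?_,
    fun t _ => (h.rep_spec (f t)).2.1⟩
  rw [← slope_sub u u' hx, one_mul]
  exact abs_slope_le _ hx

theorem isContinuousRep_curvature (h : CoeffBounds a c K) {f : ℝ → DomA a}
    (hf : ContinuousOn f (Ici 0)) :
    IsContinuousRep (fun t => h.curvature (f t)) (fun t => weakD2 (toH2w (f t))) :=
  ⟨continuousOn_rep hf h.continuousOn_curvature fun u u' _ hx => h.abs_curvature_sub_le u u' hx,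
    fun t _ => h.curvature_ae_eq (f t)⟩

theorem CoeffBounds.integrableOn_weighted_sq (h : CoeffBounds a c K) {f : ℝ → H2w a}
    (hf : ContinuousOn f (Ici 0)) (T : ℝ) :
    IntegrableOn (fun p : ℝ × ℝ => profile (f p.1) p.2 ^ 2 / a p.2 *
      (1 - p.2 * coeffDeriv a p.2 / a p.2)) (Ioo 0 T ×ˢ Ioo 0 1) := by
  obtain ⟨B, hB⟩ := isCompact_Icc.exists_bound_of_continuousOn (hf.mono (Icc_subset_Ici_self : Icc 0 T ⊆ _))
  have hsub : Ioo 0 T ×ˢ Ioo (0 : ℝ) 1 ⊆ Ici 0 ×ˢ Icc 0 1 :=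
    prod_mono (fun t ht => ht.1.le) Ioo_subset_Icc_self
  have hms : MeasurableSet (Ioo 0 T ×ˢ Ioo (0 : ℝ) 1) := measurableSet_Ioo.prod measurableSet_Ioo
  have hmaps : MapsTo Prod.snd (Ioo 0 T ×ˢ Ioo (0 : ℝ) 1) (Ioo 0 1) := fun p hp => hp.2
  have hpc := (isContinuousRep_profile h hf).1.mono hsub
  have hac := h.continuousOn_Ioo.comp continuousOn_snd hmaps
  have hfac := h.continuousOn_factor.comp continuousOn_snd hmaps
  have hcont := ((hpc.pow 2).div hac fun p hp => (h.pos (Ioo_subset_Ioc_self hp.2)).ne').mul hfac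
  refine Integrable.mono' (g := fun _ => B * B / c * (1 + |K|))
    (integrableOn_const (by
      rw [Measure.volume_eq_prod, Measure.prod_prod]
      simp))
    (hcont.aestronglyMeasurable hms) ?_
  filter_upwards [ae_restrict_mem hms] with p hp
  have hBp := hB p.1 (Ioo_subset_Icc_self hp.1)
  have hB0 := (norm_nonneg _).trans hBp
  have hc := h.c_pos
  refine (h.abs_weighted_sq_le (f p.1) hp.2).trans ?_
  refine (mul_le_mul_of_nonneg_left (add_le_add_right (le_abs_self K) 1)
    (div_nonneg (mul_self_nonneg _) hc.le)).trans ?_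
  gcongr

end DegenerateBeam

end

/-! ### The identity -/

theorem mainTheorem9 (a : ℝ → ℝ)
    (ha : DegenerateBeam.WeaklyDegenerate a ∨ DegenerateBeam.StronglyDegenerate a)
    (y₀ : DegenerateBeam.DomA a) (y₁ : DegenerateBeam.H2w a) (y : ℝ → DegenerateBeam.DomA a)
    (hy : DegenerateBeam.IsClassicalSolution a y₀ y₁ y) :
    ∃ y_t y_x y_xx : ℝ → ℝ → ℝ,
      DegenerateBeam.IsContinuousRep y_t (fun t => DegenerateBeam.toL2w (DegenerateBeam.timeDeriv y t)) ∧
      DegenerateBeam.IsContinuousRep y_x (fun t => DegenerateBeam.weakD1 (DegenerateBeam.toH2w (y t))) ∧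
      DegenerateBeam.IsContinuousRep y_xx (fun t => DegenerateBeam.weakD2 (DegenerateBeam.toH2w (y t))) ∧
      ∀ T : ℝ, 0 < T →
        MemLp (fun t => y_xx t 1) 2 (volume.restrict (Ioo 0 T)) ∧
        (∀ t ∈ Icc 0 T, IntegrableOn (fun x => x * y_t t x * y_x t x / a x) (Ioo 0 1)) ∧
        IntegrableOn
          (fun p : ℝ × ℝ => (y_t p.1 p.2) ^ 2 / a p.2 *
            (1 - p.2 * DegenerateBeam.coeffDeriv a p.2 / a p.2))
          (Ioo 0 T ×ˢ Ioo 0 1) ∧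
        IntegrableOn (fun p : ℝ × ℝ => (y_xx p.1 p.2) ^ 2) (Ioo 0 T ×ˢ Ioo 0 1) ∧
        (1 / 2 : ℝ) * (∫ t in Ioo 0 T, (y_xx t 1) ^ 2) =
          (∫ x in Ioo 0 1,
            (x * y_t T x * y_x T x / a x - x * y_t 0 x * y_x 0 x / a x)) +
          (1 / 2 : ℝ) * (∫ p in Ioo 0 T ×ˢ Ioo 0 1,
            (y_t p.1 p.2) ^ 2 / a p.2 *
              (1 - p.2 * DegenerateBeam.coeffDeriv a p.2 / a p.2)) +
          (3 / 2 : ℝ) * (∫ p in Ioo 0 T ×ˢ Ioo 0 1, (y_xx p.1 p.2) ^ 2) := by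
  open DegenerateBeam in
  obtain ⟨c, K, h⟩ := exists_coeffBounds ha
  have hvc := hy.continuousOn_timeDeriv
  have hw := isContinuousRep_curvature h hy.continuousOn_DomA
  refine ⟨fun t => profile (timeDeriv y t), fun t => slope (toH2w (y t)),
    fun t => h.curvature (y t), isContinuousRep_profile h hvc,
    isContinuousRep_slope h hy.contDiffOn_H2w.continuousOn, hw, fun T hT => ?_⟩
  have hw1 : ContinuousOn (fun t => h.curvature (y t) 1) (Icc 0 T) :=
    hw.1.comp (f := fun t : ℝ => (t, (1 : ℝ))) (by fun_prop) fun t ht =>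
      ⟨ht.1, right_mem_Icc.mpr zero_le_one⟩
  have hw1i : IntegrableOn (fun t => h.curvature (y t) 1 ^ 2) (Ioo 0 T) :=
    (hw1.pow 2).integrableOn_Icc.mono_set Ioo_subset_Icc_self
  have hI := h.integrableOn_weighted_sq hvc T
  have hW : IntegrableOn (fun p : ℝ × ℝ => h.curvature (y p.1) p.2 ^ 2) (Ioo 0 T ×ˢ Ioo 0 1) := by
    have h1 : ContinuousOn (fun p : ℝ × ℝ => h.curvature (y p.1) p.2 ^ 2)
        (Icc 0 T ×ˢ Icc (0 : ℝ) 1) :=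
      (hw.1.mono (prod_mono Icc_subset_Ici_self subset_rfl)).pow 2
    exact (h1.integrableOn_compact (isCompact_Icc.prod isCompact_Icc)).mono_set
      (prod_mono Ioo_subset_Icc_self Ioo_subset_Icc_self)
  refine ⟨?_, fun t _ => h.integrableOn_profile_mul_slope _ _, hI, hW, ?_⟩
  · rw [memLp_two_iff_integrable_sq
      ((hw1.mono Ioo_subset_Icc_self).aestronglyMeasurable measurableSet_Ioo)]
    exact hw1i
  · have hFTC := hy.integral_deriv_inner h hT
    simp only [h.inner_toL2w_slope, h.inner_eq_integral,
      fun t => h.inner_opA_slope (y t) (h.continuousOn_curvature (y t)) (h.curvature_ae_eq (y t))]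
      at hFTC
    rw [← integral_sub (h.integrableOn_profile_mul_slope _ _)
      (h.integrableOn_profile_mul_slope _ _)] at hFTC
    rw [Measure.volume_eq_prod] at hI hW ⊢
    rw [setIntegral_prod _ hI, setIntegral_prod _ hW, ← hFTC]
    rw [IntegrableOn, ← Measure.prod_restrict] at hI hW
    have hI' : IntegrableOn (fun t => ∫ x in Ioo (0 : ℝ) 1, profile (timeDeriv y t) x ^ 2 / a x *
        (1 - x * coeffDeriv a x / a x)) (Ioo 0 T) := hI.integral_prod_left
    have hW' : IntegrableOn (fun t => ∫ x in Ioo (0 : ℝ) 1, h.curvature (y t) x ^ 2) (Ioo 0 T) :=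
      hW.integral_prod_left
    have hA : IntegrableOn (fun t => -(1 / 2 * ∫ x in Ioo (0 : ℝ) 1,
        profile (timeDeriv y t) x ^ 2 / a x * (1 - x * coeffDeriv a x / a x))) (Ioo 0 T) :=
      (hI'.const_mul _).neg
    have hB : IntegrableOn (fun t => 3 / 2 * (∫ x in Ioo (0 : ℝ) 1, h.curvature (y t) x ^ 2) -
        1 / 2 * h.curvature (y t) 1 ^ 2) (Ioo 0 T) := (hW'.const_mul _).sub (hw1i.const_mul _)
    rw [integral_sub hA hB, integral_sub (hW'.const_mul _) (hw1i.const_mul _), integral_neg,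
      integral_const_mul, integral_const_mul, integral_const_mul]
    ring
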